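/- Let $k$ be a field of characteristic different from $2$ and let $n\ge 1$. Let $E(n)$ be the Hopf algebra over $k$ generated by $c,x_1,\dots,x_n$ with relations $c^2=1$, $x_i^2=0$, $cx_i=-x_ic$ for all $i$, and $x_ix_j=-x_jx_i$ for $i<j$, with $\Delta(c)=c\otimes c$, $\Delta(x_i)=1\otimes x_i+x_i\otimes c$, $\varepsilon(c)=1$, $\varepsilon(x_i)=0$, $S(c)=c$, $S(x_i)=cx_i$. Let $\tau$ be the flip and let $*$ denote convolution of linear maps. A coquasi-triangular structure on a Hopf algebra $H$ is a convolution invertible linear map $r:H\otimes H\to k$ such that, for all $g,h,l\in H$, $$r(hg\otimes l)=\sum r(h\otimes l_{(1)})\,r(g\otimes l_{(2)}),\qquad r(h\otimes gl)=\sum r(h_{(1)}\otimes l)\,r(h_{(2)}\otimes g),$$ $$\sum g_{(1)}h_{(1)}\,r(h_{(2)}\otimes g_{(2)})=\sum r(h_{(1)}\otimes g_{(1)})\,h_{(2)}g_{(2)};$$ it is cotriangular if moreover $(r\tau)*r=\varepsilon\otimes\varepsilon$. Let $\mathcal U$ be the set of coquasi-triangular structures of $E(n)$. Let $Z_L(H)$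 be the group, under convolution, of lazy left $2$-cocycles of $H$, that is, of convolution invertible linear maps $\sigma:H\otimes H\to k$ such that, for all $g,h,l,m\in H$, $$\sum \sigma(g_{(1)}\otimes h_{(1)})\,\sigma(g_{(2)}h_{(2)}\otimes m)=\sum \sigma(h_{(1)}\otimes m_{(1)})\,\sigma(g\otimes h_{(2)}m_{(2)}),$$ $$\sum \sigma(h_{(1)}\otimes l_{(1)})\,h_{(2)}l_{(2)}=\sum h_{(1)}l_{(1)}\,\sigma(h_{(2)}\otimes l_{(2)}).$$ It acts by $\sigma\cdot r=(\sigma\tau)*r*\sigma^{-1}$. Let $r_0=1^*\otimes 1^*+c^*\otimes 1^*+1^*\otimes c^*-c^*\otimes c^*$, where $1^*$ and $c^*$ belong to the basis of $E(n)^*$ dual to the basis of $E(n)$ consisting of the elements $x_P$ and $cx_P$ ($P\subseteq\{1,\dots,n\}$, $x_P$ being the product of the $x_j$, $j\in P$, in increasing order); in other words, $r_0$ is the pull-back, along the Hopf algebra projection $E(n)\to k\mathbb Z_2$ with $c\mapsto c$ and $x_i\mapsto 0$, of the nontrivial bicharacter of $\mathbb Z_2=\langle c\rangle$. Then the set of all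 cotriangular structures on $E(n)$ is a single $Z_L(E(n))$-orbit in $\mathcal U$, namely the orbit $Z_L(E(n))\cdot r_0$ of $r_0$. -/

import Mathlib

open scoped TensorProduct
open WithConv

noncomputable section

/-! ### Convolution algebras -/

namespace Conv

/-- Precomposition with a coalgebra map `f : C → D`, as a homomorphism of convolution
monoids `Hom(D, k) → Hom(C, k)`. -/
def pull {k C D : Type*} [Field k] [AddCommGroup C] [Module k C] [Coalgebra k C]
    [AddCommGroup D] [Module k D] [Coalgebra k D] (f : C →ₗc[k] D) :
    WithConv (D →ₗ[k] k) →* WithConv (C →ₗ[k] k) where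
  toFun σ := toConv (σ.ofConv ∘ₗ f.toLinearMap)
  map_one' := by
    ext x
    simp
  map_mul' σ ρ := by
    apply WithConv.ext
    exact LinearMap.convMul_comp_coalgHom_distrib σ ρ f

/-- Composition with the unit map `k → A`, as a homomorphism of convolution monoids
`Hom(C, k) → Hom(C, A)`: a scalar-valued map is regarded as an `A`-valued one. -/
def scalar {k C : Type*} [Field k] [AddCommGroup C] [Module k C] [Coalgebra k C]
    (A : Type*) [Ring A] [Algebra k A] :
    WithConv (C →ₗ[k] k) →* WithConv (C →ₗ[k] A) where
  toFun σ := toConv (Algebra.linearMap k A ∘ₗ σ.ofConv)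
  map_one' := by
    ext x
    simp
  map_mul' σ ρ := by
    apply WithConv.ext
    exact LinearMap.algHom_comp_convMul_distrib (Algebra.ofId k A) σ ρ

end Conv

namespace Bialg

variable (k H : Type*) [Field k] [Ring H] [Bialgebra k H]

/-- Linear maps `H ⊗ H → k`, with the convolution product
`(σ * ρ)(h ⊗ l) = ∑ σ(h₁ ⊗ l₁) ρ(h₂ ⊗ l₂)` and the unit `ε ⊗ ε`. -/
abbrev Form : Type _ := WithConv (H ⊗[k] H →ₗ[k] k)

/-- The multiplication of `H`, as an element of the convolution algebra `Hom(H ⊗ H, H)`. -/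
def mu : WithConv (H ⊗[k] H →ₗ[k] H) := toConv (LinearMap.mul' k H)

/-- The opposite multiplication `h ⊗ l ↦ l h`. -/
def muOp : WithConv (H ⊗[k] H →ₗ[k] H) :=
  toConv (LinearMap.mul' k H ∘ₗ (TensorProduct.comm k H H).toLinearMap)

/-- The flip `τ`, as a coalgebra map. -/
def flipMap : H ⊗[k] H →ₗc[k] H ⊗[k] H :=
  ((Bialgebra.TensorProduct.comm k H H : H ⊗[k] H ≃ₐc[k] H ⊗[k] H) : H ⊗[k] H →ₐc[k] H ⊗[k] H)

/-- `g ⊗ h ⊗ m ↦ ε(m) g ⊗ h`. -/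
def proj12 : (H ⊗[k] H) ⊗[k] H →ₗc[k] H ⊗[k] H :=
  (Coalgebra.TensorProduct.rid k k (H ⊗[k] H)).toCoalgHom.comp
    (Coalgebra.TensorProduct.map (.id k _) (Coalgebra.counitCoalgHom k H))

/-- `g ⊗ h ⊗ m ↦ ε(g) h ⊗ m`. -/
def proj23 : (H ⊗[k] H) ⊗[k] H →ₗc[k] H ⊗[k] H :=
  Coalgebra.TensorProduct.map
    ((Coalgebra.TensorProduct.lid k H).toCoalgHom.comp
      (Coalgebra.TensorProduct.map (Coalgebra.counitCoalgHom k H) (.id k H))) (.id k H)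

/-- `g ⊗ h ⊗ m ↦ ε(h) g ⊗ m`. -/
def proj13 : (H ⊗[k] H) ⊗[k] H →ₗc[k] H ⊗[k] H :=
  Coalgebra.TensorProduct.map
    ((Coalgebra.TensorProduct.rid k k H).toCoalgHom.comp
      (Coalgebra.TensorProduct.map (.id k H) (Coalgebra.counitCoalgHom k H))) (.id k H)

/-- `g ⊗ h ⊗ m ↦ g h ⊗ m`. -/
def mulLeft : (H ⊗[k] H) ⊗[k] H →ₗc[k] H ⊗[k] H :=
  Coalgebra.TensorProduct.map (Bialgebra.mulCoalgHom k H) (.id k H)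

/-- `g ⊗ h ⊗ m ↦ g ⊗ h m`. -/
def mulRight : (H ⊗[k] H) ⊗[k] H →ₗc[k] H ⊗[k] H :=
  (Coalgebra.TensorProduct.map (.id k H) (Bialgebra.mulCoalgHom k H)).comp
    (Coalgebra.TensorProduct.assoc k k H H H).toCoalgHom

variable {k H}

/-- Left 2-cocycles: convolution invertible maps `σ` with
`∑ σ(g₁ ⊗ h₁) σ(g₂ h₂ ⊗ m) = ∑ σ(h₁ ⊗ m₁) σ(g ⊗ h₂ m₂)`. -/
structure IsLeftCocycle (σ : Form k H) : Prop where
  isUnit : IsUnit σ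
  cocycle : Conv.pull (proj12 k H) σ * Conv.pull (mulLeft k H) σ =
    Conv.pull (proj23 k H) σ * Conv.pull (mulRight k H) σ

/-- The lazy condition `∑ σ(h₁ ⊗ l₁) h₂ l₂ = ∑ h₁ l₁ σ(h₂ ⊗ l₂)`. -/
def IsLazy (σ : Form k H) : Prop :=
  Conv.scalar H σ * mu k H = mu k H * Conv.scalar H σ

/-- Coquasi-triangular structures on `H`: convolution invertible maps `r` with
`r(h g ⊗ l) = ∑ r(h ⊗ l₁) r(g ⊗ l₂)`, `r(h ⊗ g l) = ∑ r(h₁ ⊗ l) r(h₂ ⊗ g)` and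
`∑ g₁ h₁ r(h₂ ⊗ g₂) = ∑ r(h₁ ⊗ g₁) h₂ g₂`. -/
structure IsCoquasitriangular (r : Form k H) : Prop where
  isUnit : IsUnit r
  mul_left : Conv.pull (mulLeft k H) r = Conv.pull (proj13 k H) r * Conv.pull (proj23 k H) r
  mul_right : Conv.pull (mulRight k H) r = Conv.pull (proj13 k H) r * Conv.pull (proj12 k H) r
  comm : muOp k H * Conv.scalar H r = Conv.scalar H r * mu k H

/-- A coquasi-triangular structure is cotriangular if `(r ∘ τ) * r = ε ⊗ ε`, that is, if
`r ∘ τ` is the convolution inverse of `r`. -/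
structure IsCotriangular (r : Form k H) : Prop extends IsCoquasitriangular r where
  flip_mul : Conv.pull (flipMap k H) r * r = 1

/-- A lazy `σ` satisfies `∑ σ(g₁ ⊗ h₁) f(g₂ h₂ ⊗ m) = ∑ f(g₁ h₁ ⊗ m) σ(g₂ ⊗ h₂)`. -/
theorem IsLazy.commute_mulLeft {σ : Form k H} (hσ : IsLazy σ) (f : Form k H) :
    Commute (Conv.pull (proj12 k H) σ) (Conv.pull (mulLeft k H) f) := by
  apply WithConv.ext
  apply TensorProduct.ext'
  intro t m
  have hl : (Conv.scalar H σ * mu k H) t = (mu k H * Conv.scalar H σ) t := by rw [hσ]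
  rw [(Coalgebra.Repr.arbitrary k t).convMul_apply, (Coalgebra.Repr.arbitrary k t).convMul_apply]
    at hl
  have hf := congrArg (fun a => f.ofConv (a ⊗ₜ m)) hl
  change (Conv.pull (proj12 k H) σ * Conv.pull (mulLeft k H) f) (t ⊗ₜ m) =
    (Conv.pull (mulLeft k H) f * Conv.pull (proj12 k H) σ) (t ⊗ₜ m)
  rw [((Coalgebra.Repr.arbitrary k t).tmul (Coalgebra.Repr.arbitrary k m)).convMul_apply,
    ((Coalgebra.Repr.arbitrary k t).tmul (Coalgebra.Repr.arbitrary k m)).convMul_apply]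
  simp only [Coalgebra.Repr.tmul_index, Finset.sum_product, Coalgebra.Repr.tmul_left,
    Coalgebra.Repr.tmul_right]
  have key1 : ∀ a b : H ⊗[k] H,
      ∑ j ∈ (Coalgebra.Repr.arbitrary k m).index,
        (Conv.pull (proj12 k H) σ) (a ⊗ₜ (Coalgebra.Repr.arbitrary k m).left j) *
          (Conv.pull (mulLeft k H) f) (b ⊗ₜ (Coalgebra.Repr.arbitrary k m).right j) =
      σ.ofConv a * f.ofConv (LinearMap.mul' k H b ⊗ₜ m) := by
    intro a b
    conv_rhs => rw [← Coalgebra.sum_counit_smul (Coalgebra.Repr.arbitrary k m)]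
    simp [Conv.pull, proj12, mulLeft, TensorProduct.tmul_sum, Finset.mul_sum]
    refine Finset.sum_congr rfl fun j _ => ?_
    ring
  have key2 : ∀ a b : H ⊗[k] H,
      ∑ j ∈ (Coalgebra.Repr.arbitrary k m).index,
        (Conv.pull (mulLeft k H) f) (a ⊗ₜ (Coalgebra.Repr.arbitrary k m).left j) *
          (Conv.pull (proj12 k H) σ) (b ⊗ₜ (Coalgebra.Repr.arbitrary k m).right j) =
      f.ofConv (LinearMap.mul' k H a ⊗ₜ m) * σ.ofConv b := by
    intro a b
    have hm : ∑ j ∈ (Coalgebra.Repr.arbitrary k m).index,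
        Coalgebra.counit (R := k) ((Coalgebra.Repr.arbitrary k m).right j) •
          (Coalgebra.Repr.arbitrary k m).left j = m := by
      have h := congrArg (TensorProduct.rid k H)
        (Coalgebra.sum_tmul_counit_eq (Coalgebra.Repr.arbitrary k m))
      simpa only [map_sum, TensorProduct.rid_tmul, one_smul] using h
    conv_rhs => rw [← hm]
    simp [Conv.pull, proj12, mulLeft, TensorProduct.tmul_sum, Finset.sum_mul]
    refine Finset.sum_congr rfl fun j _ => ?_
    ring
  simp only [key1, key2]
  simpa [Conv.scalar, mu, TensorProduct.sum_tmul, ← Algebra.smul_def, ← Algebra.commutes,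
    ← TensorProduct.smul_tmul', mul_comm] using hf

theorem IsLazy.commute_mulRight {σ : Form k H} (hσ : IsLazy σ) (f : Form k H) :
    Commute (Conv.pull (proj23 k H) σ) (Conv.pull (mulRight k H) f) := by
  let p : H ⊗[k] (H ⊗[k] H) →ₗc[k] H ⊗[k] H :=
    (Coalgebra.TensorProduct.lid k (H ⊗[k] H)).toCoalgHom.comp
      (Coalgebra.TensorProduct.map (Coalgebra.counitCoalgHom k H) (.id k _))
  let q : H ⊗[k] (H ⊗[k] H) →ₗc[k] H ⊗[k] H :=
    Coalgebra.TensorProduct.map (.id k H) (Bialgebra.mulCoalgHom k H)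
  have hp : Conv.pull (proj23 k H) σ =
      Conv.pull (Coalgebra.TensorProduct.assoc k k H H H).toCoalgHom (Conv.pull p σ) := by
    apply WithConv.ext
    apply TensorProduct.ext_threefold
    intro a b c
    simp [Conv.pull, proj23, p, TensorProduct.smul_tmul']
  have hq : Conv.pull (mulRight k H) f =
      Conv.pull (Coalgebra.TensorProduct.assoc k k H H H).toCoalgHom (Conv.pull q f) := rfl
  rw [hp, hq]
  refine Commute.map (f := Conv.pull _) (x := Conv.pull p σ) (y := Conv.pull q f) ?_
  apply WithConv.ext
  apply TensorProduct.ext'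
  intro m t
  have hl : (Conv.scalar H σ * mu k H) t = (mu k H * Conv.scalar H σ) t := by rw [hσ]
  rw [(Coalgebra.Repr.arbitrary k t).convMul_apply, (Coalgebra.Repr.arbitrary k t).convMul_apply]
    at hl
  have hf := congrArg (fun a => f.ofConv (m ⊗ₜ a)) hl
  change (Conv.pull p σ * Conv.pull q f) (m ⊗ₜ t) = (Conv.pull q f * Conv.pull p σ) (m ⊗ₜ t)
  rw [((Coalgebra.Repr.arbitrary k m).tmul (Coalgebra.Repr.arbitrary k t)).convMul_apply,
    ((Coalgebra.Repr.arbitrary k m).tmul (Coalgebra.Repr.arbitrary k t)).convMul_apply]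
  simp only [Coalgebra.Repr.tmul_index, Finset.sum_product_right, Coalgebra.Repr.tmul_left,
    Coalgebra.Repr.tmul_right]
  have key1 : ∀ a b : H ⊗[k] H,
      ∑ j ∈ (Coalgebra.Repr.arbitrary k m).index,
        (Conv.pull p σ) ((Coalgebra.Repr.arbitrary k m).left j ⊗ₜ a) *
          (Conv.pull q f) ((Coalgebra.Repr.arbitrary k m).right j ⊗ₜ b) =
      σ.ofConv a * f.ofConv (m ⊗ₜ LinearMap.mul' k H b) := by
    intro a b
    conv_rhs => rw [← Coalgebra.sum_counit_smul (Coalgebra.Repr.arbitrary k m)]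
    simp [Conv.pull, p, q, TensorProduct.sum_tmul, Finset.mul_sum, ← TensorProduct.smul_tmul']
    refine Finset.sum_congr rfl fun j _ => ?_
    ring
  have key2 : ∀ a b : H ⊗[k] H,
      ∑ j ∈ (Coalgebra.Repr.arbitrary k m).index,
        (Conv.pull q f) ((Coalgebra.Repr.arbitrary k m).left j ⊗ₜ a) *
          (Conv.pull p σ) ((Coalgebra.Repr.arbitrary k m).right j ⊗ₜ b) =
      f.ofConv (m ⊗ₜ LinearMap.mul' k H a) * σ.ofConv b := by
    intro a b
    have hm : ∑ j ∈ (Coalgebra.Repr.arbitrary k m).index,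
        Coalgebra.counit (R := k) ((Coalgebra.Repr.arbitrary k m).right j) •
          (Coalgebra.Repr.arbitrary k m).left j = m := by
      have h := congrArg (TensorProduct.rid k H)
        (Coalgebra.sum_tmul_counit_eq (Coalgebra.Repr.arbitrary k m))
      simpa only [map_sum, TensorProduct.rid_tmul, one_smul] using h
    conv_rhs => rw [← hm]
    simp [Conv.pull, p, q, TensorProduct.sum_tmul, Finset.sum_mul, ← TensorProduct.smul_tmul']
    refine Finset.sum_congr rfl fun j _ => ?_
    ring
  simp only [key1, key2]
  simpa [Conv.scalar, mu, TensorProduct.tmul_sum, ← Algebra.smul_def, ← Algebra.commutes,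
    mul_comm] using hf

variable (k H)

/-- The group `Z_L(H)` of lazy left 2-cocycles under convolution. -/
def lazyCocycles : Subgroup (Form k H)ˣ where
  carrier := {σ | IsLeftCocycle (σ : Form k H) ∧ IsLazy (σ : Form k H)}
  one_mem' := by
    refine ⟨⟨isUnit_one, by simp⟩, by simp [IsLazy]⟩
  mul_mem' := by
    rintro σ ρ ⟨hσ, hσ'⟩ ⟨hρ, hρ'⟩
    refine ⟨⟨(σ * ρ).isUnit, ?_⟩, ?_⟩
    · have h1 := hσ.cocycle
      have h2 := hρ.cocycle
      simp only [Units.val_mul, map_mul]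
      rw [(hρ'.commute_mulLeft _).mul_mul_mul_comm, (hρ'.commute_mulRight _).mul_mul_mul_comm,
        h1, h2]
    · have h1 : Commute (Conv.scalar H (σ : Form k H)) (mu k H) := hσ'
      have h2 : Commute (Conv.scalar H (ρ : Form k H)) (mu k H) := hρ'
      simpa [IsLazy] using (h1.mul_left h2).eq
  inv_mem' := by
    rintro σ ⟨hσ, hσ'⟩
    refine ⟨⟨(σ⁻¹).isUnit, ?_⟩, ?_⟩
    · have h1 : Units.map (Conv.pull (proj12 k H)) σ * Units.map (Conv.pull (mulLeft k H)) σ =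
          Units.map (Conv.pull (proj23 k H)) σ * Units.map (Conv.pull (mulRight k H)) σ :=
        Units.ext hσ.cocycle
      have c1 : Commute (Units.map (Conv.pull (proj12 k H)) σ)
          (Units.map (Conv.pull (mulLeft k H)) σ) := Units.ext (hσ'.commute_mulLeft _).eq
      have c2 : Commute (Units.map (Conv.pull (proj23 k H)) σ)
          (Units.map (Conv.pull (mulRight k H)) σ) := Units.ext (hσ'.commute_mulRight _).eq
      have h2 := congrArg (fun u => u⁻¹) (c1.eq.symm.trans (h1.trans c2.eq))
      simp only [mul_inv_rev, ← map_inv] at h2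
      exact congrArg Units.val h2
    · have h1 : Commute (Units.map (Conv.scalar H) σ : WithConv (H ⊗[k] H →ₗ[k] H)) (mu k H) := hσ'
      exact h1.units_inv_left

/-- `Z_L(H)` as a type. -/
def ZL : Type _ := lazyCocycles k H

instance : Group (ZL k H) := inferInstanceAs (Group (lazyCocycles k H))

variable {k H} in
/-- The underlying map `H ⊗ H → k` of a lazy cocycle, as a convolution unit. -/
def ZL.toUnits : ZL k H →* (Form k H)ˣ := (lazyCocycles k H).subtype

/-- The action `σ • r = (σ ∘ τ) * r * σ⁻¹`, on all maps `r : H ⊗ H → k`. -/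
instance : MulAction (ZL k H) (Form k H) where
  smul σ r := Conv.pull (flipMap k H) (σ.toUnits : Form k H) * r * ((σ.toUnits)⁻¹ : (Form k H)ˣ)
  one_smul r := by
    change Conv.pull (flipMap k H) (ZL.toUnits (1 : ZL k H) : Form k H) * r *
      ((ZL.toUnits (1 : ZL k H))⁻¹ : (Form k H)ˣ) = r
    simp
  mul_smul σ ρ r := by
    change Conv.pull (flipMap k H) (ZL.toUnits (σ * ρ) : Form k H) * r *
        ((ZL.toUnits (σ * ρ))⁻¹ : (Form k H)ˣ) =
      Conv.pull (flipMap k H) (σ.toUnits : Form k H) *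
        (Conv.pull (flipMap k H) (ρ.toUnits : Form k H) * r * ((ρ.toUnits)⁻¹ : (Form k H)ˣ)) *
        ((σ.toUnits)⁻¹ : (Form k H)ˣ)
    simp [mul_assoc]

end Bialg

/-! ### The Hopf algebras `E(n)` -/

/-- The generators `c, x_1, …, x_n` (the latter indexed from `0`). -/
inductive EGen (n : ℕ) : Type
  | c : EGen n
  | x : Fin n → EGen n

/-- The defining relations of `E(n)`. -/
inductive ERel (k : Type*) [Field k] (n : ℕ) :
    FreeAlgebra k (EGen n) → FreeAlgebra k (EGen n) → Prop
  | c_sq : ERel k n (FreeAlgebra.ι k .c * FreeAlgebra.ι k .c) 1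
  | x_sq (i : Fin n) : ERel k n (FreeAlgebra.ι k (.x i) * FreeAlgebra.ι k (.x i)) 0
  | c_x (i : Fin n) : ERel k n (FreeAlgebra.ι k .c * FreeAlgebra.ι k (.x i))
      (-(FreeAlgebra.ι k (.x i) * FreeAlgebra.ι k .c))
  | x_x (i j : Fin n) (h : i < j) : ERel k n (FreeAlgebra.ι k (.x i) * FreeAlgebra.ι k (.x j))
      (-(FreeAlgebra.ι k (.x j) * FreeAlgebra.ι k (.x i)))

/-- The algebra `E(n)`. -/
def E (k : Type*) [Field k] (n : ℕ) : Type _ := RingQuot (ERel k n)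

namespace E

variable (k : Type*) [Field k] (n : ℕ)

instance : Ring (E k n) := inferInstanceAs (Ring (RingQuot (ERel k n)))
instance : Algebra k (E k n) := inferInstanceAs (Algebra k (RingQuot (ERel k n)))

def c : E k n := RingQuot.mkAlgHom k (ERel k n) (FreeAlgebra.ι k .c)

variable {n} in
def x (i : Fin n) : E k n := RingQuot.mkAlgHom k (ERel k n) (FreeAlgebra.ι k (.x i))

theorem c_mul_c : c k n * c k n = 1 := by
  simpa [c] using! RingQuot.mkAlgHom_rel k (ERel.c_sq (k := k) (n := n))

variable {n} in
theorem x_mul_self (i : Fin n) : x k i * x k i = 0 := by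
  simpa [x] using! RingQuot.mkAlgHom_rel k (ERel.x_sq (k := k) i)

variable {n} in
theorem c_mul_x (i : Fin n) : c k n * x k i = -(x k i * c k n) := by
  simpa [x, c] using! RingQuot.mkAlgHom_rel k (ERel.c_x (k := k) i)

variable {n} in
theorem x_mul_x_of_lt (i j : Fin n) (h : i < j) : x k i * x k j = -(x k j * x k i) := by
  simpa [x] using! RingQuot.mkAlgHom_rel k (ERel.x_x (k := k) i j h)

variable {n} in
theorem x_mul_x (i j : Fin n) : x k i * x k j = -(x k j * x k i) := by
  rcases lt_trichotomy i j with h | rfl | h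
  · exact x_mul_x_of_lt k i j h
  · simp [x_mul_self]
  · rw [x_mul_x_of_lt k j i h, neg_neg]

variable {k n}

/-- The universal property of `E(n)`. -/
def lift {A : Type*} [Ring A] [Algebra k A] (c' : A) (x' : Fin n → A) (hc : c' * c' = 1)
    (hx : ∀ i, x' i * x' i = 0) (hcx : ∀ i, c' * x' i = -(x' i * c'))
    (hxx : ∀ i j, x' i * x' j = -(x' j * x' i)) : E k n →ₐ[k] A :=
  RingQuot.liftAlgHom k ⟨FreeAlgebra.lift k (fun g : EGen n => EGen.rec c' x' g), by
    rintro a b (_ | i | i | ⟨i, j, h⟩)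
    · simpa using hc
    · simpa using hx i
    · simpa using hcx i
    · simpa using hxx i j⟩

section lift
variable {A : Type*} [Ring A] [Algebra k A] (c' : A) (x' : Fin n → A) (hc : c' * c' = 1)
    (hx : ∀ i, x' i * x' i = 0) (hcx : ∀ i, c' * x' i = -(x' i * c'))
    (hxx : ∀ i j, x' i * x' j = -(x' j * x' i))

@[simp] theorem lift_c : lift c' x' hc hx hcx hxx (c k n) = c' := by
  unfold lift c
  erw [RingQuot.liftAlgHom_mkAlgHom_apply]
  simp

@[simp] theorem lift_x (i : Fin n) : lift c' x' hc hx hcx hxx (x k i) = x' i := by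
  unfold lift x
  erw [RingQuot.liftAlgHom_mkAlgHom_apply]
  simp

theorem hom_ext {f g : E k n →ₐ[k] A} (h : f (c k n) = g (c k n))
    (h' : ∀ i, f (x k i) = g (x k i)) : f = g := by
  apply RingQuot.ringQuot_ext'
  apply FreeAlgebra.hom_ext
  funext a
  cases a with
  | c => exact h
  | x i => exact h' i

end lift

variable (k n)

/-- `Δ(c) = c ⊗ c`, `Δ(x_i) = 1 ⊗ x_i + x_i ⊗ c`. -/
def comulHom : E k n →ₐ[k] E k n ⊗[k] E k n :=
  lift (c k n ⊗ₜ c k n) (fun i => 1 ⊗ₜ x k i + x k i ⊗ₜ c k n)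
    (by simp [c_mul_c, Algebra.TensorProduct.one_def])
    (by
      intro i
      simp [mul_add, add_mul, x_mul_self, c_mul_x, TensorProduct.tmul_neg])
    (by
      intro i
      simp [mul_add, add_mul, c_mul_c, c_mul_x, TensorProduct.tmul_neg, TensorProduct.neg_tmul,
        add_comm])
    (by
      intro i j
      simp only [mul_add, add_mul, Algebra.TensorProduct.tmul_mul_tmul, one_mul, mul_one, c_mul_c,
        c_mul_x, TensorProduct.tmul_neg, neg_add]
      rw [x_mul_x k i j]
      simp only [TensorProduct.tmul_neg, TensorProduct.neg_tmul, neg_neg]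
      abel)

/-- `ε(c) = 1`, `ε(x_i) = 0`. -/
def counitHom : E k n →ₐ[k] k := lift 1 (fun _ => 0) (by simp) (by simp) (by simp) (by simp)

instance : Bialgebra k (E k n) :=
  Bialgebra.ofAlgHom (comulHom k n) (counitHom k n)
    (by
      apply hom_ext
      · simp [comulHom]
      · intro i
        simp [comulHom, TensorProduct.add_tmul, TensorProduct.tmul_add,
          Algebra.TensorProduct.one_def, add_assoc])
    (by
      apply hom_ext
      · simp [comulHom, counitHom]
      · intro i
        simp [comulHom, counitHom])
    (by
      apply hom_ext
      · simp [comulHom, counitHom]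
      · intro i
        simp [comulHom, counitHom])

/-- `S(c) = c`, `S(x_i) = c x_i`, extended to an algebra map into the opposite algebra. -/
def antipodeHom : E k n →ₐ[k] (E k n)ᵐᵒᵖ :=
  lift (MulOpposite.op (c k n)) (fun i => MulOpposite.op (c k n * x k i))
    (by simp [← MulOpposite.op_mul, c_mul_c])
    (by
      intro i
      rw [← MulOpposite.op_mul]
      nth_rw 1 [c_mul_x]
      rw [neg_mul, mul_assoc, ← mul_assoc (c k n) (c k n), c_mul_c, one_mul, x_mul_self]
      simp)
    (by
      intro i
      rw [← MulOpposite.op_mul, ← MulOpposite.op_mul, ← MulOpposite.op_neg, mul_assoc,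
        ← mul_neg, c_mul_x, neg_neg])
    (by
      intro i j
      have h : ∀ i j : Fin n, c k n * x k i * (c k n * x k j) = -(x k i * x k j) := by
        intro i j
        rw [c_mul_x, neg_mul, mul_assoc, ← mul_assoc (c k n) (c k n), c_mul_c, one_mul]
      rw [← MulOpposite.op_mul, ← MulOpposite.op_mul, ← MulOpposite.op_neg, h, h, x_mul_x k j i])

/-- The antipode. -/
def S : E k n →ₗ[k] E k n :=
  (MulOpposite.opLinearEquiv k).symm.toLinearMap ∘ₗ (antipodeHom k n).toLinearMap

theorem S_mul (a b : E k n) : S k n (a * b) = S k n b * S k n a := by simp [S]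

theorem S_one : S k n 1 = 1 := by simp [S]

theorem S_c : S k n (c k n) = c k n := by simp [S, antipodeHom]

variable {n} in
theorem S_x (i : Fin n) : S k n (x k i) = c k n * x k i := by simp [S, antipodeHom]

variable {k n} in
theorem induction {P : E k n → Prop} (hk : ∀ r : k, P (algebraMap k _ r)) (hc : P (c k n))
    (hx : ∀ i, P (x k i)) (hmul : ∀ a b, P a → P b → P (a * b))
    (hadd : ∀ a b, P a → P b → P (a + b)) (a : E k n) : P a := by
  obtain ⟨b, rfl⟩ := RingQuot.mkAlgHom_surjective k (ERel k n) a
  induction b using FreeAlgebra.induction with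
  | grade0 r =>
    exact (AlgHom.commutes (RingQuot.mkAlgHom k (ERel k n)) r).symm ▸ hk r
  | grade1 g =>
    cases g with
    | c => exact hc
    | x i => exact hx i
  | mul a b ha hb =>
    rw [map_mul]
    exact hmul _ _ ha hb
  | add a b ha hb =>
    rw [map_add]
    exact hadd _ _ ha hb

theorem comul_c : Coalgebra.comul (R := k) (c k n) = c k n ⊗ₜ c k n :=
  lift_c _ _ _ _ _ _

variable {n} in
theorem comul_x (i : Fin n) :
    Coalgebra.comul (R := k) (x k i) = 1 ⊗ₜ x k i + x k i ⊗ₜ c k n :=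
  lift_x _ _ _ _ _ _ i

theorem counit_c : Coalgebra.counit (R := k) (c k n) = 1 :=
  lift_c _ _ _ _ _ _

variable {n} in
theorem counit_x (i : Fin n) : Coalgebra.counit (R := k) (x k i) = 0 :=
  lift_x _ _ _ _ _ _ i

instance : HopfAlgebra k (E k n) where
  antipode := S k n
  mul_antipode_rTensor_comul := by
    have key : ∀ (X Y : E k n ⊗[k] E k n) (r : k),
        LinearMap.mul' k _ ((S k n).rTensor _ X) = algebraMap k _ r →
        LinearMap.mul' k _ ((S k n).rTensor _ (X * Y)) =
          algebraMap k _ r * LinearMap.mul' k _ ((S k n).rTensor _ Y) := by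
      intro X Y r hX
      induction Y with
      | zero => simp
      | add a b ha hb => simp [mul_add, ha, hb]
      | tmul a b =>
        have h : LinearMap.mul' k _ ((S k n).rTensor _ (X * (a ⊗ₜ b))) =
            S k n a * LinearMap.mul' k _ ((S k n).rTensor _ X) * b := by
          clear hX
          induction X with
          | zero => simp
          | add u v hu hv => simp [mul_add, add_mul, hu, hv]
          | tmul u v => simp [S_mul, mul_assoc]
        rw [h, hX, ← Algebra.commutes]
        simp [mul_assoc]
    apply LinearMap.ext
    intro a
    simp only [LinearMap.comp_apply, Algebra.linearMap_apply]
    induction a using E.induction with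
    | hk r => simp [Algebra.TensorProduct.one_def, Algebra.algebraMap_eq_smul_one, S_one]
    | hc => simp [comul_c, counit_c, S_c, c_mul_c]
    | hx i => simp [comul_x, counit_x, S_x, S_one, c_mul_x, mul_assoc, c_mul_c]
    | hmul a b ha hb => rw [Bialgebra.comul_mul, key _ _ _ ha, hb, Bialgebra.counit_mul, map_mul]
    | hadd a b ha hb => simp only [map_add, ha, hb]
  mul_antipode_lTensor_comul := by
    have key : ∀ (X Y : E k n ⊗[k] E k n) (r : k),
        LinearMap.mul' k _ ((S k n).lTensor _ Y) = algebraMap k _ r →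
        LinearMap.mul' k _ ((S k n).lTensor _ (X * Y)) =
          LinearMap.mul' k _ ((S k n).lTensor _ X) * algebraMap k _ r := by
      intro X Y r hY
      induction X with
      | zero => simp
      | add a b ha hb => simp [add_mul, ha, hb]
      | tmul a b =>
        have h : LinearMap.mul' k _ ((S k n).lTensor _ ((a ⊗ₜ b) * Y)) =
            a * LinearMap.mul' k _ ((S k n).lTensor _ Y) * S k n b := by
          clear hY
          induction Y with
          | zero => simp
          | add u v hu hv => simp [mul_add, add_mul, hu, hv]
          | tmul u v => simp [S_mul, mul_assoc]
        rw [h, hY, mul_assoc, Algebra.commutes]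
        simp [mul_assoc]
    apply LinearMap.ext
    intro a
    simp only [LinearMap.comp_apply, Algebra.linearMap_apply]
    induction a using E.induction with
    | hk r => simp [Algebra.TensorProduct.one_def, Algebra.algebraMap_eq_smul_one, S_one]
    | hc => simp [comul_c, counit_c, S_c, c_mul_c]
    | hx i => simp [comul_x, counit_x, S_x, S_c, c_mul_x]
    | hmul a b ha hb => rw [Bialgebra.comul_mul, key _ _ _ hb, ha, Bialgebra.counit_mul, map_mul]
    | hadd a b ha hb => simp only [map_add, ha, hb]

/-- The algebra map `χ : E(n) → k` with `χ(c) = -1`, `χ(x_i) = 0`. -/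
def chi : E k n →ₐ[k] k := lift (-1) (fun _ => 0) (by simp) (by simp) (by simp) (by simp)

/-- The element `1*` of the basis dual to `{x_P, c x_P}`: it maps `1` to `1`, and `c` and all
`c^a x_P` with `P ≠ ∅` to `0`. -/
def oneDual : E k n →ₗ[k] k :=
  (2⁻¹ : k) • ((counitHom k n).toLinearMap + (chi k n).toLinearMap)

/-- The element `c*` of the basis dual to `{x_P, c x_P}`: it maps `c` to `1`, and `1` and all
`c^a x_P` with `P ≠ ∅` to `0`. -/
def cDual : E k n →ₗ[k] k :=
  (2⁻¹ : k) • ((counitHom k n).toLinearMap - (chi k n).toLinearMap)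

/-- `f ⊗ g` as a linear map `E(n) ⊗ E(n) → k`. -/
def tensorForm (f g : E k n →ₗ[k] k) : Bialg.Form k (E k n) :=
  toConv (LinearMap.mul' k k ∘ₗ TensorProduct.map f g)

/-- `r_0 = 1* ⊗ 1* + c* ⊗ 1* + 1* ⊗ c* - c* ⊗ c*`: the pull-back along the projection
`E(n) → k[ℤ/2]`, `x_i ↦ 0`, of the bicharacter of `ℤ/2 = ⟨c⟩` with value `-1` on `(c, c)`. -/
def r0 : Bialg.Form k (E k n) :=
  tensorForm k n (oneDual k n) (oneDual k n) + tensorForm k n (cDual k n) (oneDual k n) +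
    tensorForm k n (oneDual k n) (cDual k n) - tensorForm k n (cDual k n) (cDual k n)

end E

end

/-! A coquasi-triangular structure on E(n) is determined by the matrix B = (r(x_i ⊗ x_j)): the
commutation axiom forces r(c ⊗ c) = -1 and r(c ⊗ x_i) = r(x_i ⊗ c) = 0, and multiplicativity in both
arguments does the rest (`isNormal_of_isCoquasitriangular`, `form_eq_of_isNormal`). Cotriangularity
forces B to be symmetric, and r_0 is the cotriangular structure with B = 0.

Two facts hold for every bialgebra. Twisting by a lazy cocycle preserves cotriangularity
(`IsCotriangular.twist`), so the orbit of r_0 consists of cotriangular structures. The quotient s⁻¹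
* r of two coquasi-triangular structures is a lazy left cocycle (`isLazy_of_mul_eq`,
`isLeftCocycle_of_mul_eq`), which is the source of cocycles for the converse.

Let r be cotriangular with matrix B. Rescaling the x_i by t in the first argument gives a
coquasi-triangular s with matrix tB (`isCoquasitriangular_scaleForm`). Since r_0 is its own inverse,
σ = r_0 * s is a lazy cocycle; it has matrix tB and σ(c ⊗ c) = 1. Comparing values at x_i ⊗ x_j in
(σ · r_0) * σ = (σ ∘ τ) * r_0 shows that σ · r_0 has matrix -t(B + Bᵀ) = -2tB. For t = -1/2 this is
B, so σ · r_0 = r. -/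

noncomputable section

/-! ### Forms on two and three tensor factors, and permutations of the factors -/

namespace Bialg

variable (k H : Type*) [Field k] [Ring H] [Bialgebra k H]

/-- `g ⊗ h ⊗ m ↦ h ⊗ g ⊗ m`. -/
def swapLeft : (H ⊗[k] H) ⊗[k] H →ₗc[k] (H ⊗[k] H) ⊗[k] H :=
  Coalgebra.TensorProduct.map (flipMap k H) (.id k H)

/-- `g ⊗ h ⊗ m ↦ m ⊗ g ⊗ h`. -/
def cycle : (H ⊗[k] H) ⊗[k] H →ₗc[k] (H ⊗[k] H) ⊗[k] H :=
  (Coalgebra.TensorProduct.assoc k k H H H).symm.toCoalgHom.comp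
    (((Bialgebra.TensorProduct.comm k (H ⊗[k] H) H :
        (H ⊗[k] H) ⊗[k] H ≃ₐc[k] H ⊗[k] (H ⊗[k] H)) :
      (H ⊗[k] H) ⊗[k] H →ₐc[k] H ⊗[k] (H ⊗[k] H)) : _ →ₗc[k] _)

variable {k H}

section apply

variable (f : Form k H) (F : WithConv ((H ⊗[k] H) ⊗[k] H →ₗ[k] k)) (g h m : H)

theorem pull_flipMap_apply : (Conv.pull (flipMap k H) f).ofConv (g ⊗ₜ h) = f.ofConv (h ⊗ₜ g) := rfl

theorem pull_swapLeft_apply :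
    (Conv.pull (swapLeft k H) F).ofConv ((g ⊗ₜ h) ⊗ₜ m) = F.ofConv ((h ⊗ₜ g) ⊗ₜ m) := rfl

theorem pull_cycle_apply :
    (Conv.pull (cycle k H) F).ofConv ((g ⊗ₜ h) ⊗ₜ m) = F.ofConv ((m ⊗ₜ g) ⊗ₜ h) := rfl

theorem pull_proj12_apply : (Conv.pull (proj12 k H) f).ofConv ((g ⊗ₜ h) ⊗ₜ m) =
    Coalgebra.counit (R := k) m * f.ofConv (g ⊗ₜ h) := by
  simp [Conv.pull, proj12]

theorem pull_proj23_apply : (Conv.pull (proj23 k H) f).ofConv ((g ⊗ₜ h) ⊗ₜ m) =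
    Coalgebra.counit (R := k) g * f.ofConv (h ⊗ₜ m) := by
  simp [Conv.pull, proj23, ← TensorProduct.smul_tmul']

theorem pull_proj13_apply : (Conv.pull (proj13 k H) f).ofConv ((g ⊗ₜ h) ⊗ₜ m) =
    Coalgebra.counit (R := k) h * f.ofConv (g ⊗ₜ m) := by
  simp [Conv.pull, proj13, ← TensorProduct.smul_tmul']

end apply

theorem form_ext {f g : Form k H} (h : ∀ a b, f.ofConv (a ⊗ₜ b) = g.ofConv (a ⊗ₜ b)) : f = g :=
  WithConv.ext (TensorProduct.ext' h)

theorem form3_ext {F G : WithConv ((H ⊗[k] H) ⊗[k] H →ₗ[k] k)}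
    (h : ∀ a b c, F.ofConv ((a ⊗ₜ b) ⊗ₜ c) = G.ofConv ((a ⊗ₜ b) ⊗ₜ c)) : F = G :=
  WithConv.ext (TensorProduct.ext_threefold h)

section permutations

variable (f : Form k H) (F : WithConv ((H ⊗[k] H) ⊗[k] H →ₗ[k] k))

theorem flip_flip : Conv.pull (flipMap k H) (Conv.pull (flipMap k H) f) = f :=
  form_ext fun _ _ => rfl

theorem swapLeft_swapLeft : Conv.pull (swapLeft k H) (Conv.pull (swapLeft k H) F) = F :=
  form3_ext fun _ _ _ => rfl

theorem swapLeft_proj12 : Conv.pull (swapLeft k H) (Conv.pull (proj12 k H) f) =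
    Conv.pull (proj12 k H) (Conv.pull (flipMap k H) f) :=
  form3_ext fun _ _ _ => by
    simp only [pull_swapLeft_apply, pull_proj12_apply, pull_flipMap_apply]

theorem swapLeft_proj13 : Conv.pull (swapLeft k H) (Conv.pull (proj13 k H) f) =
    Conv.pull (proj23 k H) f :=
  form3_ext fun _ _ _ => by
    simp only [pull_swapLeft_apply, pull_proj13_apply, pull_proj23_apply]

theorem swapLeft_proj23 : Conv.pull (swapLeft k H) (Conv.pull (proj23 k H) f) =
    Conv.pull (proj13 k H) f :=
  form3_ext fun _ _ _ => by
    simp only [pull_swapLeft_apply, pull_proj13_apply, pull_proj23_apply]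

theorem cycle_proj12 : Conv.pull (cycle k H) (Conv.pull (proj12 k H) f) =
    Conv.pull (proj13 k H) (Conv.pull (flipMap k H) f) :=
  form3_ext fun _ _ _ => by
    simp only [pull_cycle_apply, pull_proj12_apply, pull_proj13_apply, pull_flipMap_apply]

theorem cycle_proj13 : Conv.pull (cycle k H) (Conv.pull (proj13 k H) f) =
    Conv.pull (proj23 k H) (Conv.pull (flipMap k H) f) :=
  form3_ext fun _ _ _ => by
    simp only [pull_cycle_apply, pull_proj13_apply, pull_proj23_apply, pull_flipMap_apply]

theorem cycle_proj23 : Conv.pull (cycle k H) (Conv.pull (proj23 k H) f) =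
    Conv.pull (proj12 k H) f :=
  form3_ext fun _ _ _ => by
    simp only [pull_cycle_apply, pull_proj12_apply, pull_proj23_apply]

theorem cycle_mulRight : Conv.pull (cycle k H) (Conv.pull (mulRight k H) f) =
    Conv.pull (mulLeft k H) (Conv.pull (flipMap k H) f) :=
  form3_ext fun _ _ _ => rfl

theorem cycle_cycle_mulLeft :
    Conv.pull (cycle k H) (Conv.pull (cycle k H) (Conv.pull (mulLeft k H) f)) =
      Conv.pull (mulRight k H) (Conv.pull (flipMap k H) f) :=
  form3_ext fun _ _ _ => rfl

/-- Both sides are g ⊗ h ⊗ m ↦ f(g ⊗ m h). This carries exchange rules for `mulLeft` over to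
`mulRight`. -/
theorem cycle_swapLeft_mulRight :
    Conv.pull (cycle k H) (Conv.pull (swapLeft k H) (Conv.pull (mulRight k H) f)) =
      Conv.pull (cycle k H) (Conv.pull (cycle k H) (Conv.pull (swapLeft k H)
        (Conv.pull (mulLeft k H) (Conv.pull (flipMap k H) f)))) :=
  form3_ext fun _ _ _ => rfl

end permutations

/-! ### Exchange rules, quotients and twists of coquasi-triangular structures -/

theorem sum_counit_right_smul {C : Type*} [AddCommGroup C] [Module k C] [Coalgebra k C] {m : C}
    {ι : Type*} (R : Coalgebra.Repr k m ι) :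
    ∑ j ∈ R.index, Coalgebra.counit (R := k) (R.right j) • R.left j = m := by
  have h := congrArg (TensorProduct.rid k C) (Coalgebra.sum_tmul_counit_eq R)
  simpa only [map_sum, TensorProduct.rid_tmul, one_smul] using h

/-- If `r` intertwines the multiplication and its opposite, then
`∑ r(g₁ ⊗ h₁) f(g₂ h₂ ⊗ m) = ∑ f(h₁ g₁ ⊗ m) r(g₂ ⊗ h₂)`. -/
theorem proj12_mul_mulLeft {r : Form k H}
    (hr : muOp k H * Conv.scalar H r = Conv.scalar H r * mu k H) (f : Form k H) :
    Conv.pull (proj12 k H) r * Conv.pull (mulLeft k H) f =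
      Conv.pull (swapLeft k H) (Conv.pull (mulLeft k H) f) * Conv.pull (proj12 k H) r := by
  apply WithConv.ext
  apply TensorProduct.ext'
  intro t m
  set T := Coalgebra.Repr.arbitrary k t
  set M := Coalgebra.Repr.arbitrary k m
  have hl : (Conv.scalar H r * mu k H) t = (muOp k H * Conv.scalar H r) t := by rw [hr]
  rw [T.convMul_apply, T.convMul_apply] at hl
  have hf := congrArg (fun a => f.ofConv (a ⊗ₜ m)) hl
  change (Conv.pull (proj12 k H) r * Conv.pull (mulLeft k H) f) (t ⊗ₜ m) =
    (Conv.pull (swapLeft k H) (Conv.pull (mulLeft k H) f) * Conv.pull (proj12 k H) r) (t ⊗ₜ m)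
  rw [(T.tmul M).convMul_apply, (T.tmul M).convMul_apply]
  simp only [Coalgebra.Repr.tmul_index, Finset.sum_product, Coalgebra.Repr.tmul_left,
    Coalgebra.Repr.tmul_right]
  -- The pulled-back r sees m only through ε, so the sum over Δ(m) collapses.
  have key1 : ∀ a b : H ⊗[k] H,
      ∑ j ∈ M.index, (Conv.pull (proj12 k H) r) (a ⊗ₜ M.left j) *
          (Conv.pull (mulLeft k H) f) (b ⊗ₜ M.right j) =
      r.ofConv a * f.ofConv (LinearMap.mul' k H b ⊗ₜ m) := by
    intro a b
    conv_rhs => rw [← Coalgebra.sum_counit_smul M]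
    simp [Conv.pull, proj12, mulLeft, TensorProduct.tmul_sum, Finset.mul_sum]
    refine Finset.sum_congr rfl fun j _ => ?_
    ring
  have key2 : ∀ a b : H ⊗[k] H,
      ∑ j ∈ M.index,
        (Conv.pull (swapLeft k H) (Conv.pull (mulLeft k H) f)) (a ⊗ₜ M.left j) *
          (Conv.pull (proj12 k H) r) (b ⊗ₜ M.right j) =
      f.ofConv (LinearMap.mul' k H (flipMap k H a) ⊗ₜ m) * r.ofConv b := by
    intro a b
    conv_rhs => rw [← sum_counit_right_smul M]
    simp [Conv.pull, proj12, mulLeft, swapLeft, TensorProduct.tmul_sum, Finset.sum_mul]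
    refine Finset.sum_congr rfl fun j _ => ?_
    ring
  simp only [key1, key2]
  have hflip : ∀ a : H ⊗[k] H, (muOp k H) a = LinearMap.mul' k H (flipMap k H a) := fun _ => rfl
  simp only [hflip] at hf
  simpa [Conv.scalar, mu, TensorProduct.sum_tmul, ← Algebra.smul_def, ← Algebra.commutes,
    ← TensorProduct.smul_tmul', mul_comm] using hf

/-- The exchange rule of `proj12_mul_mulLeft`, for the flipped form and with the factors rotated
twice. -/
theorem proj23_mul_mulRight {r : Form k H}
    (hr : muOp k H * Conv.scalar H r = Conv.scalar H r * mu k H) (f : Form k H) :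
    Conv.pull (proj23 k H) r * Conv.pull (mulRight k H) f =
      Conv.pull (cycle k H) (Conv.pull (swapLeft k H) (Conv.pull (mulRight k H) f)) *
        Conv.pull (proj23 k H) r := by
  have h := congrArg (fun F => Conv.pull (cycle k H) (Conv.pull (cycle k H) F))
    (proj12_mul_mulLeft hr (Conv.pull (flipMap k H) f))
  simpa only [map_mul, cycle_proj12, cycle_proj13, cycle_cycle_mulLeft, flip_flip,
    ← cycle_swapLeft_mulRight] using h

/-- The same exchange rule carried to the first and third factors: ∑ f(m₁ g₁ ⊗ h) r(g₂ ⊗ m₂) = ∑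
r(g₁ ⊗ m₁) f(g₂ m₂ ⊗ h). -/
theorem mul_proj13 {r : Form k H}
    (hr : muOp k H * Conv.scalar H r = Conv.scalar H r * mu k H) (f : Form k H) :
    Conv.pull (cycle k H) (Conv.pull (mulLeft k H) f) * Conv.pull (proj13 k H) r =
      Conv.pull (proj13 k H) r *
        Conv.pull (cycle k H) (Conv.pull (swapLeft k H) (Conv.pull (mulLeft k H) f)) := by
  have h := congrArg (fun F => Conv.pull (cycle k H) (Conv.pull (swapLeft k H) F))
    (proj12_mul_mulLeft hr f)
  simpa only [map_mul, swapLeft_proj12, cycle_proj12, swapLeft_swapLeft, flip_flip] using h.symm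

/-- Both sides of the cocycle identity equal r₂₃ * r₁₃ * r₁₂, as in the Yang–Baxter equation. -/
theorem IsCoquasitriangular.isLeftCocycle {r : Form k H} (hr : IsCoquasitriangular r) :
    IsLeftCocycle r where
  isUnit := hr.isUnit
  cocycle := by
    rw [proj12_mul_mulLeft hr.comm, hr.mul_left, hr.mul_right, map_mul, swapLeft_proj13,
      swapLeft_proj23, mul_assoc]

/-- The quotient `s⁻¹ * r` of two coquasi-triangular structures is lazy. -/
theorem IsCoquasitriangular.isLazy_of_mul_eq {r s σ : Form k H} (hr : IsCoquasitriangular r)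
    (hs : IsCoquasitriangular s) (h : s * σ = r) : IsLazy σ := by
  have hu : IsUnit (Conv.scalar H s) := hs.isUnit.map _
  apply hu.mul_left_cancel
  -- Both r and s intertwine the multiplication with its opposite, in the same direction, so s⁻¹ * r
  -- commutes with the multiplication.
  rw [← mul_assoc, ← mul_assoc, ← map_mul, h, ← hs.comm, mul_assoc, ← map_mul, h, hr.comm]

/-- The quotient `s⁻¹ * r` of two coquasi-triangular structures is a left 2-cocycle. -/
theorem IsCoquasitriangular.isLeftCocycle_of_mul_eq {r s σ : Form k H}
    (hr : IsCoquasitriangular r) (hs : IsCoquasitriangular s) (h : s * σ = r) :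
    IsLeftCocycle σ where
  isUnit := by
    obtain ⟨u, rfl⟩ := hs.isUnit
    exact (Units.isUnit_units_mul u σ).1 (h ▸ hr.isUnit)
  cocycle := by
    have hσ := hr.isLazy_of_mul_eq hs h
    have hc := hr.isLeftCocycle.cocycle
    rw [← h] at hc
    simp only [map_mul] at hc
    -- Laziness of σ splits the cocycle identity of s * σ into that of s times that of σ; the first
    -- is then cancelled.
    rw [(hσ.commute_mulLeft s).mul_mul_mul_comm, (hσ.commute_mulRight s).mul_mul_mul_comm,
      ← hs.isLeftCocycle.cocycle] at hc
    exact ((hs.isUnit.map _).mul (hs.isUnit.map _)).mul_left_cancel hc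

/-- Precompose the lazy identity with τ, a coalgebra map which turns the multiplication into its
opposite. -/
theorem IsLazy.flip {σ : Form k H} (hσ : IsLazy σ) :
    Conv.scalar H (Conv.pull (flipMap k H) σ) * muOp k H =
      muOp k H * Conv.scalar H (Conv.pull (flipMap k H) σ) := by
  have h : (Conv.scalar H σ * mu k H).ofConv ∘ₗ (flipMap k H).toLinearMap =
      (mu k H * Conv.scalar H σ).ofConv ∘ₗ (flipMap k H).toLinearMap := by rw [hσ]
  rw [LinearMap.convMul_comp_coalgHom_distrib, LinearMap.convMul_comp_coalgHom_distrib] at h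
  exact WithConv.ext h

/-- The cotriangular structures are stable under the action of lazy cocycles. -/
theorem IsCotriangular.twist {r σ R : Form k H} (hr : IsCotriangular r) (hσ : IsLeftCocycle σ)
    (hσ' : IsLazy σ) (hR : R * σ = Conv.pull (flipMap k H) σ * r) : IsCotriangular R := by
  have hu := hσ.isUnit
  have huR : IsUnit R := by
    obtain ⟨u, rfl⟩ := hu
    exact (Units.isUnit_mul_units R u).1 (hR ▸ (u.isUnit.map _).mul hr.isUnit)
  have hflip : Conv.pull (flipMap k H) R * R = 1 := by
    have h1 := congrArg (Conv.pull (flipMap k H)) hR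
    simp only [map_mul, flip_flip] at h1
    -- (Rτ) * R * σ = (Rτ) * (στ) * r = σ * (rτ) * r = σ.
    have h2 : Conv.pull (flipMap k H) R * R * σ = σ := by
      rw [mul_assoc, hR, ← mul_assoc, h1, mul_assoc, hr.flip_mul, mul_one]
    exact hu.mul_right_cancel (h2.trans (one_mul σ).symm)
  have hR' : ∀ {M : Type _} [Monoid M] (φ : Form k H →* M),
      φ (Conv.pull (flipMap k H) σ) * φ r = φ R * φ σ := fun φ => by
    rw [← map_mul, ← map_mul, hR]
  have hleft : Conv.pull (mulLeft k H) R =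
      Conv.pull (proj13 k H) R * Conv.pull (proj23 k H) R := by
    -- The cocycle identity of σ evaluated at m ⊗ g ⊗ h, and next at g ⊗ m ⊗ h. With the original at
    -- g ⊗ h ⊗ m, these are the three instances used below.
    have c1 := congrArg (Conv.pull (cycle k H)) hσ.cocycle
    have c2 := congrArg (fun F => Conv.pull (cycle k H) (Conv.pull (swapLeft k H) F)) hσ.cocycle
    simp only [map_mul, cycle_proj12, cycle_proj13, cycle_proj23, cycle_mulRight, swapLeft_proj12,
      swapLeft_proj23, flip_flip] at c1 c2
    -- With the cocycle expression cancelled on the right, no σ⁻¹ occurs: R * σ is traded for (στ) *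
    -- r, and the exchange rules move r₁₃ and r₂₃ past values of σ on products.
    apply ((hu.map (Conv.pull (proj12 k H))).mul (hu.map (Conv.pull (mulLeft k H)))).mul_right_cancel
    calc Conv.pull (mulLeft k H) R * (Conv.pull (proj12 k H) σ * Conv.pull (mulLeft k H) σ)
        = Conv.pull (proj12 k H) σ * (Conv.pull (mulLeft k H) R * Conv.pull (mulLeft k H) σ) := by
          rw [← mul_assoc, ← (hσ'.commute_mulLeft R).eq, mul_assoc]
      _ = (Conv.pull (proj12 k H) σ * Conv.pull (mulLeft k H) (Conv.pull (flipMap k H) σ)) *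
            Conv.pull (mulLeft k H) r := by
          rw [← hR', mul_assoc]
      _ = Conv.pull (proj13 k H) (Conv.pull (flipMap k H) σ) *
            (Conv.pull (cycle k H) (Conv.pull (mulLeft k H) σ) * Conv.pull (proj13 k H) r) *
              Conv.pull (proj23 k H) r := by
          rw [← c1, hr.mul_left]
          simp only [mul_assoc]
      _ = Conv.pull (proj13 k H) R * (Conv.pull (proj13 k H) σ *
            Conv.pull (cycle k H) (Conv.pull (swapLeft k H) (Conv.pull (mulLeft k H) σ))) *
              Conv.pull (proj23 k H) r := by
          rw [mul_proj13 hr.comm, ← mul_assoc, hR']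
          simp only [mul_assoc]
      _ = Conv.pull (proj13 k H) R * (Conv.pull (proj23 k H) (Conv.pull (flipMap k H) σ) *
            (Conv.pull (cycle k H) (Conv.pull (swapLeft k H) (Conv.pull (mulRight k H) σ)) *
              Conv.pull (proj23 k H) r)) := by
          rw [c2]
          simp only [mul_assoc]
      _ = Conv.pull (proj13 k H) R * Conv.pull (proj23 k H) R *
            (Conv.pull (proj12 k H) σ * Conv.pull (mulLeft k H) σ) := by
          rw [← proj23_mul_mulRight hr.comm, ← mul_assoc (Conv.pull (proj23 k H) _), hR',
            hσ.cocycle]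
          simp only [mul_assoc]
  refine ⟨⟨huR, hleft, ?_, ?_⟩, hflip⟩
  · have hinv : Conv.pull (mulLeft k H) (Conv.pull (flipMap k H) R) =
        Conv.pull (proj23 k H) (Conv.pull (flipMap k H) R) *
          Conv.pull (proj13 k H) (Conv.pull (flipMap k H) R) := by
      apply (huR.map (Conv.pull (mulLeft k H))).mul_right_cancel
      rw [← map_mul, hflip, map_one, hleft, mul_assoc,
        ← mul_assoc (Conv.pull (proj13 k H) _), ← map_mul, hflip, map_one, one_mul, ← map_mul,
        hflip, map_one]
    have h := congrArg (fun F => Conv.pull (cycle k H) (Conv.pull (cycle k H) F)) hinv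
    simpa only [map_mul, cycle_proj12, cycle_proj13, cycle_proj23, cycle_cycle_mulLeft,
      flip_flip] using h
  · have hRs : Conv.scalar H (Conv.pull (flipMap k H) σ) * Conv.scalar H r =
        Conv.scalar H R * Conv.scalar H σ := by rw [← map_mul, ← map_mul, hR]
    apply (hu.map (Conv.scalar H)).mul_right_cancel
    rw [mul_assoc, ← map_mul, hR, map_mul, ← mul_assoc, ← hσ'.flip, mul_assoc, hr.comm,
      ← mul_assoc, hRs, mul_assoc, mul_assoc, hσ']

end Bialg

/-! ### Constant and scalar-valued maps in a convolution algebra -/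

namespace Conv

variable {k C A : Type*} [Field k] [AddCommGroup C] [Module k C] [Coalgebra k C]
  [Ring A] [Algebra k A]

variable (k C A) in
/-- The linear map sending `a` to `x ↦ ε(x) a`. -/
def constLinear : A →ₗ[k] WithConv (C →ₗ[k] A) where
  toFun a := toConv ((LinearMap.toSpanSingleton k A a) ∘ₗ Coalgebra.counit)
  map_add' a b := by ext x; simp
  map_smul' t a := by
    apply WithConv.ext
    apply LinearMap.ext
    intro x
    exact smul_comm (Coalgebra.counit (R := k) x) t a

theorem constLinear_apply (a : A) (x : C) :
    constLinear k C A a x = Coalgebra.counit (R := k) x • a := rfl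

theorem constLinear_mul_apply (a : A) (f : WithConv (C →ₗ[k] A)) (x : C) :
    (constLinear k C A a * f) x = a * f x := by
  rw [(Coalgebra.Repr.arbitrary k x).convMul_apply]
  conv_rhs => rw [← Coalgebra.sum_counit_smul (Coalgebra.Repr.arbitrary k x)]
  simp [constLinear_apply, Finset.mul_sum]

theorem mul_constLinear_apply (a : A) (f : WithConv (C →ₗ[k] A)) (x : C) :
    (f * constLinear k C A a) x = f x * a := by
  rw [(Coalgebra.Repr.arbitrary k x).convMul_apply]
  conv_rhs => rw [← Bialg.sum_counit_right_smul (Coalgebra.Repr.arbitrary k x)]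
  simp [constLinear_apply, Finset.sum_mul]

variable (k C A) in
/-- The algebra map sending `a` to `x ↦ ε(x) a`. -/
def const : A →ₐ[k] WithConv (C →ₗ[k] A) :=
  AlgHom.ofLinearMap (constLinear k C A)
    (by ext x; simp [constLinear, Algebra.algebraMap_eq_smul_one])
    (by
      intro a b
      apply WithConv.ext
      apply LinearMap.ext
      intro x
      refine Eq.trans ?_ (constLinear_mul_apply a _ x).symm
      exact (mul_smul_comm (Coalgebra.counit (R := k) x) a b).symm)

theorem const_mul_apply (a : A) (f : WithConv (C →ₗ[k] A)) (x : C) :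
    (const k C A a * f) x = a * f x := constLinear_mul_apply a f x

theorem mul_const_apply (a : A) (f : WithConv (C →ₗ[k] A)) (x : C) :
    (f * const k C A a) x = f x * a := mul_constLinear_apply a f x

theorem scalar_apply (u : WithConv (C →ₗ[k] k)) (x : C) :
    Conv.scalar A u x = algebraMap k A (u x) := rfl

theorem commute_const_scalar (a : A) (u : WithConv (C →ₗ[k] k)) :
    Commute (const k C A a) (Conv.scalar A u) := by
  apply WithConv.ext
  apply LinearMap.ext
  intro x
  exact ((const_mul_apply a _ x).trans (Algebra.commutes _ a).symm).trans
    (mul_const_apply a _ x).symm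

end Conv

/-! ### Multiplicativity in each argument, in terms of the convolution algebra of H -/

namespace Bialg

variable {k H : Type*} [Field k] [Ring H] [Bialgebra k H]

/-- The map `l ↦ f(h ⊗ l)`, as a function of `h`. -/
def evalLeft (f : Form k H) : H →ₗ[k] WithConv (H →ₗ[k] k) :=
  (WithConv.linearEquiv k _).symm.toLinearMap ∘ₗ TensorProduct.curry f.ofConv

/-- The map `h ↦ f(h ⊗ l)`, as a function of `l`. -/
def evalRight (f : Form k H) : H →ₗ[k] WithConv (H →ₗ[k] k) :=
  (WithConv.linearEquiv k _).symm.toLinearMap ∘ₗ (TensorProduct.curry f.ofConv).flip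

theorem evalLeft_apply (f : Form k H) (a b : H) : evalLeft f a b = f.ofConv (a ⊗ₜ b) := rfl

theorem evalRight_apply (f : Form k H) (a b : H) : evalRight f b a = f.ofConv (a ⊗ₜ b) := rfl

/-- The counits absorb Δ(a) and Δ(b), so only Δ(l) survives, and it gives a convolution product of
functions of l. -/
theorem proj13_mul_proj23_apply (f g : Form k H) (a b l : H) :
    (Conv.pull (proj13 k H) f * Conv.pull (proj23 k H) g).ofConv ((a ⊗ₜ b) ⊗ₜ l) =
      (evalLeft f a * evalLeft g b) l := by
  set A := Coalgebra.Repr.arbitrary k a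
  set B := Coalgebra.Repr.arbitrary k b
  set L := Coalgebra.Repr.arbitrary k l
  refine (((A.tmul B).tmul L).convMul_apply (Conv.pull (proj13 k H) f)
    (Conv.pull (proj23 k H) g)).trans ?_
  rw [L.convMul_apply]
  simp only [Coalgebra.Repr.tmul_index, Coalgebra.Repr.tmul_left, Coalgebra.Repr.tmul_right,
    pull_proj13_apply, pull_proj23_apply, evalLeft_apply, Finset.sum_product_right]
  refine Finset.sum_congr rfl fun j _ => ?_
  conv_rhs => rw [← sum_counit_right_smul A, ← Coalgebra.sum_counit_smul B]
  simp only [TensorProduct.sum_tmul, map_sum, ← TensorProduct.smul_tmul', map_smul, smul_eq_mul,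
    Finset.sum_mul_sum]
  rw [Finset.sum_comm]
  refine Finset.sum_congr rfl fun i _ => Finset.sum_congr rfl fun i' _ => ?_
  ring

theorem proj13_mul_proj12_apply (f g : Form k H) (a b l : H) :
    (Conv.pull (proj13 k H) f * Conv.pull (proj12 k H) g).ofConv ((a ⊗ₜ b) ⊗ₜ l) =
      (evalRight f l * evalRight g b) a := by
  set A := Coalgebra.Repr.arbitrary k a
  set B := Coalgebra.Repr.arbitrary k b
  set L := Coalgebra.Repr.arbitrary k l
  refine (((A.tmul B).tmul L).convMul_apply (Conv.pull (proj13 k H) f)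
    (Conv.pull (proj12 k H) g)).trans ?_
  rw [A.convMul_apply]
  simp only [Coalgebra.Repr.tmul_index, Coalgebra.Repr.tmul_left, Coalgebra.Repr.tmul_right,
    pull_proj13_apply, pull_proj12_apply, evalRight_apply, Finset.sum_product]
  refine Finset.sum_congr rfl fun j _ => ?_
  conv_rhs => rw [← sum_counit_right_smul L, ← Coalgebra.sum_counit_smul B]
  simp only [TensorProduct.tmul_sum, map_sum, TensorProduct.tmul_smul, map_smul, smul_eq_mul,
    Finset.sum_mul_sum]
  rw [Finset.sum_comm]
  refine Finset.sum_congr rfl fun i _ => Finset.sum_congr rfl fun i' _ => ?_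
  ring

/-- Turns an axiom on three tensor factors into a homomorphism property into the convolution
algebra, which can be propagated from generators. -/
theorem mul_left_iff (f : Form k H) :
    Conv.pull (mulLeft k H) f = Conv.pull (proj13 k H) f * Conv.pull (proj23 k H) f ↔
      ∀ a b, evalLeft f (a * b) = evalLeft f a * evalLeft f b := by
  constructor
  · intro h a b
    apply WithConv.ext
    apply LinearMap.ext
    intro l
    exact (congrArg (fun F => F.ofConv ((a ⊗ₜ b) ⊗ₜ l)) h).trans (proj13_mul_proj23_apply f f a b l)
  · intro h
    refine form3_ext fun a b l => ?_
    rw [proj13_mul_proj23_apply, ← h]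
    rfl

theorem mul_right_iff (f : Form k H) :
    Conv.pull (mulRight k H) f = Conv.pull (proj13 k H) f * Conv.pull (proj12 k H) f ↔
      ∀ b l, evalRight f (b * l) = evalRight f l * evalRight f b := by
  constructor
  · intro h b l
    apply WithConv.ext
    apply LinearMap.ext
    intro a
    exact (congrArg (fun F => F.ofConv ((a ⊗ₜ b) ⊗ₜ l)) h).trans (proj13_mul_proj12_apply f f a b l)
  · intro h
    refine form3_ext fun a b l => ?_
    rw [proj13_mul_proj12_apply, ← h]
    rfl

theorem evalLeft_one_mul (f g : Form k H) :
    evalLeft (f * g) 1 = evalLeft f 1 * evalLeft g 1 := by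
  apply WithConv.ext
  apply LinearMap.ext
  intro l
  set L := Coalgebra.Repr.arbitrary k l
  let O : Coalgebra.Repr k (1 : H) Unit :=
    ⟨{()}, fun _ => 1, fun _ => 1, by simp [Algebra.TensorProduct.one_def]⟩
  refine ((O.tmul L).convMul_apply f g).trans ((L.convMul_apply _ _).trans ?_).symm
  simp [O, evalLeft_apply]

theorem evalRight_one_mul (f g : Form k H) :
    evalRight (f * g) 1 = evalRight f 1 * evalRight g 1 := by
  apply WithConv.ext
  apply LinearMap.ext
  intro l
  set L := Coalgebra.Repr.arbitrary k l
  let O : Coalgebra.Repr k (1 : H) Unit :=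
    ⟨{()}, fun _ => 1, fun _ => 1, by simp [Algebra.TensorProduct.one_def]⟩
  refine ((L.tmul O).convMul_apply f g).trans ((L.convMul_apply _ _).trans ?_).symm
  simp [O, evalRight_apply]

theorem evalLeft_one_one : evalLeft (1 : Form k H) 1 = 1 := by
  ext l
  simp [evalLeft]

theorem evalRight_one_one : evalRight (1 : Form k H) 1 = 1 := by
  ext l
  simp [evalRight]

/-- As 1 is group-like, f ↦ f(1 ⊗ -) respects convolution. So f(1 ⊗ -) is an idempotent with a left
inverse. -/
theorem evalLeft_one {f : Form k H} (hu : IsUnit f)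
    (h : ∀ a b, evalLeft f (a * b) = evalLeft f a * evalLeft f b) : evalLeft f 1 = 1 := by
  obtain ⟨u, rfl⟩ := hu
  have h1 := h 1 1
  have h2 := evalLeft_one_mul (↑u⁻¹ : Form k H) u
  rw [Units.inv_mul, evalLeft_one_one] at h2
  rw [mul_one] at h1
  have h3 := congrArg (fun v => evalLeft (↑u⁻¹ : Form k H) 1 * v) h1
  simp only [← mul_assoc, ← h2, one_mul] at h3
  exact h3.symm

theorem evalRight_one {f : Form k H} (hu : IsUnit f)
    (h : ∀ b l, evalRight f (b * l) = evalRight f l * evalRight f b) : evalRight f 1 = 1 := by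
  obtain ⟨u, rfl⟩ := hu
  have h1 := h 1 1
  have h2 := evalRight_one_mul (↑u⁻¹ : Form k H) u
  rw [Units.inv_mul, evalRight_one_one] at h2
  rw [mul_one] at h1
  have h3 := congrArg (fun v => evalRight (↑u⁻¹ : Form k H) 1 * v) h1
  simp only [← mul_assoc, ← h2, one_mul] at h3
  exact h3.symm

/-! ### The commutation axiom with one argument fixed -/

theorem convMul_tmul_apply {A : Type*} [Ring A] [Algebra k A]
    (F G : WithConv (H ⊗[k] H →ₗ[k] A)) {a b : H} {ι κ : Type*}
    (R : Coalgebra.Repr k a ι) (S : Coalgebra.Repr k b κ) :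
    (F * G) (a ⊗ₜ b) = ∑ i ∈ R.index, ∑ j ∈ S.index,
      F (R.left i ⊗ₜ S.left j) * G (R.right i ⊗ₜ S.right j) := by
  rw [(R.tmul S).convMul_apply]
  simp [Finset.sum_product]

variable (k H) in
/-- The identity map, as an element of the convolution algebra of `H`. -/
def idConv : WithConv (H →ₗ[k] H) := toConv LinearMap.id

/-- The map `l ↦ f(h ⊗ l) 1`, as an algebra map in `h`. -/
def scalarLeft (f : Form k H) (h1 : evalLeft f 1 = 1)
    (hmul : ∀ a b, evalLeft f (a * b) = evalLeft f a * evalLeft f b) :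
    H →ₐ[k] WithConv (H →ₗ[k] H) :=
  AlgHom.ofLinearMap
    { toFun := fun a => Conv.scalar H (evalLeft f a)
      map_add' := fun a b => by
        apply WithConv.ext
        apply LinearMap.ext
        intro x
        exact (congrArg (algebraMap k H) (by simp [evalLeft])).trans
          (map_add (algebraMap k H) (evalLeft f a x) (evalLeft f b x))
      map_smul' := fun t a => by
        apply WithConv.ext
        apply LinearMap.ext
        intro x
        have h : evalLeft f (t • a) x = t • evalLeft f a x := by simp [evalLeft_apply]
        exact (congrArg (algebraMap k H) h).trans
          (Algebra.linearMap k H |>.map_smul t (evalLeft f a x)) }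
    (by simp [h1]) (by simp [hmul])

theorem commute_const_scalarLeft (f : Form k H) (h1 : evalLeft f 1 = 1)
    (hmul : ∀ a b, evalLeft f (a * b) = evalLeft f a * evalLeft f b) (a b : H) :
    Commute (Conv.const k H H a) (scalarLeft f h1 hmul b) :=
  Conv.commute_const_scalar a (evalLeft f b)

/-- The map `h ↦ ∑ h₁ f(h₂ ⊗ -)`. -/
def mulEval (f : Form k H) (h1 : evalLeft f 1 = 1)
    (hmul : ∀ a b, evalLeft f (a * b) = evalLeft f a * evalLeft f b) :
    H →ₐ[k] WithConv (H →ₗ[k] H) :=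
  (Algebra.TensorProduct.lift (Conv.const k H H) (scalarLeft f h1 hmul)
    (commute_const_scalarLeft f h1 hmul)).comp (Bialgebra.comulAlgHom k H)

/-- The map `h ↦ ∑ f(h₁ ⊗ -) h₂`. -/
def evalMul (f : Form k H) (h1 : evalLeft f 1 = 1)
    (hmul : ∀ a b, evalLeft f (a * b) = evalLeft f a * evalLeft f b) :
    H →ₐ[k] WithConv (H →ₗ[k] H) :=
  (Algebra.TensorProduct.lift (scalarLeft f h1 hmul) (Conv.const k H H)
    fun a b => (commute_const_scalarLeft f h1 hmul b a).symm).comp (Bialgebra.comulAlgHom k H)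

theorem sum_conv_apply {C A ι : Type*} [AddCommGroup C] [Module k C] [Ring A] [Algebra k A]
    (s : Finset ι) (F : ι → WithConv (C →ₗ[k] A)) (x : C) :
    (∑ i ∈ s, F i) x = ∑ i ∈ s, F i x := by
  change (WithConv.linearEquiv k _ (∑ i ∈ s, F i)) x = _
  rw [map_sum, LinearMap.sum_apply]
  rfl

/-- For fixed h the commutation axiom reads id * P(h) = Q(h) * id with algebra maps P and Q, so it
passes to products in h formally. -/
theorem muOp_mul_scalar_apply (f : Form k H) (h1 : evalLeft f 1 = 1)
    (hmul : ∀ a b, evalLeft f (a * b) = evalLeft f a * evalLeft f b) (h g : H) :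
    (muOp k H * Conv.scalar H f) (h ⊗ₜ g) = (idConv k H * mulEval f h1 hmul h) g := by
  set R := Coalgebra.Repr.arbitrary k h
  set G := Coalgebra.Repr.arbitrary k g
  have hP : mulEval f h1 hmul h =
      ∑ i ∈ R.index, Conv.const k H H (R.left i) * Conv.scalar H (evalLeft f (R.right i)) := by
    simp only [mulEval, AlgHom.comp_apply, Bialgebra.comulAlgHom_apply]
    rw [← R.eq, map_sum]
    simp only [Algebra.TensorProduct.lift_tmul]
    rfl
  rw [convMul_tmul_apply _ _ R G, G.convMul_apply, Finset.sum_comm, hP]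
  simp only [sum_conv_apply, Conv.const_mul_apply, Finset.mul_sum, ← mul_assoc]
  rfl

theorem scalar_mul_mu_apply (f : Form k H) (h1 : evalLeft f 1 = 1)
    (hmul : ∀ a b, evalLeft f (a * b) = evalLeft f a * evalLeft f b) (h g : H) :
    (Conv.scalar H f * mu k H) (h ⊗ₜ g) = (evalMul f h1 hmul h * idConv k H) g := by
  set R := Coalgebra.Repr.arbitrary k h
  set G := Coalgebra.Repr.arbitrary k g
  have hP : evalMul f h1 hmul h =
      ∑ i ∈ R.index, Conv.scalar H (evalLeft f (R.left i)) * Conv.const k H H (R.right i) := by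
    simp only [evalMul, AlgHom.comp_apply, Bialgebra.comulAlgHom_apply]
    rw [← R.eq, map_sum]
    simp only [Algebra.TensorProduct.lift_tmul]
    rfl
  rw [convMul_tmul_apply _ _ R G, G.convMul_apply, Finset.sum_comm, hP]
  simp only [sum_conv_apply, Conv.mul_const_apply, Finset.sum_mul, mul_assoc]
  rfl

/-- Here g is fixed instead. The constants are multiplicative in g and the scalars
anti-multiplicative, so the sum over Δ(g) stays explicit, with the identity between them. -/
theorem muOp_mul_scalar_apply' (f : Form k H) (h : H) {g : H} {ι : Type*}
    (G : Coalgebra.Repr k g ι) :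
    (muOp k H * Conv.scalar H f) (h ⊗ₜ g) =
      (∑ j ∈ G.index, Conv.const k H H (G.left j) * idConv k H *
        Conv.scalar H (evalRight f (G.right j)) :
        WithConv (H →ₗ[k] H)) h := by
  set R := Coalgebra.Repr.arbitrary k h
  rw [convMul_tmul_apply _ _ R G, Finset.sum_comm, sum_conv_apply]
  refine Finset.sum_congr rfl fun j _ => ?_
  rw [mul_assoc, Conv.const_mul_apply, R.convMul_apply, Finset.mul_sum]
  simp only [← mul_assoc]
  rfl

theorem scalar_mul_mu_apply' (f : Form k H) (h : H) {g : H} {ι : Type*}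
    (G : Coalgebra.Repr k g ι) :
    (Conv.scalar H f * mu k H) (h ⊗ₜ g) =
      (∑ j ∈ G.index, Conv.scalar H (evalRight f (G.left j)) * idConv k H *
        Conv.const k H H (G.right j) :
        WithConv (H →ₗ[k] H)) h := by
  set R := Coalgebra.Repr.arbitrary k h
  rw [convMul_tmul_apply _ _ R G, Finset.sum_comm, sum_conv_apply]
  refine Finset.sum_congr rfl fun j _ => ?_
  rw [Conv.mul_const_apply, R.convMul_apply, Finset.sum_mul]
  simp only [mul_assoc]
  rfl

/-- The product of representations of `Δ(g)` and `Δ(l)`, as a representation of `Δ(g l)`. -/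
def reprMul {g l : H} {ι κ : Type*} (G : Coalgebra.Repr k g ι) (L : Coalgebra.Repr k l κ) :
    Coalgebra.Repr k (g * l) (ι × κ) where
  index := G.index ×ˢ L.index
  left p := G.left p.1 * L.left p.2
  right p := G.right p.1 * L.right p.2
  eq := by
    rw [Bialgebra.comul_mul, ← G.eq, ← L.eq, Finset.sum_mul_sum, Finset.sum_product]
    simp

/-- For a form that is anti-multiplicative in its second argument, the set of all `g` with
`∑ g₁ h₁ f(h₂ ⊗ g₂) = ∑ f(h₁ ⊗ g₁) h₂ g₂` for all `h` is closed under products. -/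
theorem comm_mul_right {f : Form k H}
    (hmul : ∀ b l, evalRight f (b * l) = evalRight f l * evalRight f b) {g l : H}
    (hg : ∀ h, (muOp k H * Conv.scalar H f) (h ⊗ₜ g) = (Conv.scalar H f * mu k H) (h ⊗ₜ g))
    (hl : ∀ h, (muOp k H * Conv.scalar H f) (h ⊗ₜ l) = (Conv.scalar H f * mu k H) (h ⊗ₜ l)) (h : H) :
    (muOp k H * Conv.scalar H f) (h ⊗ₜ (g * l)) = (Conv.scalar H f * mu k H) (h ⊗ₜ (g * l)) := by
  set G := Coalgebra.Repr.arbitrary k g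
  set L := Coalgebra.Repr.arbitrary k l
  simp only [muOp_mul_scalar_apply' f _ G, scalar_mul_mu_apply' f _ G] at hg
  simp only [muOp_mul_scalar_apply' f _ L, scalar_mul_mu_apply' f _ L] at hl
  have hg' := WithConv.ext (LinearMap.ext hg)
  have hl' := WithConv.ext (LinearMap.ext hl)
  rw [muOp_mul_scalar_apply' f _ (reprMul G L), scalar_mul_mu_apply' f _ (reprMul G L)]
  refine congrArg (fun F : WithConv (H →ₗ[k] H) => F h) ?_
  simp only [reprMul, Finset.sum_product, map_mul, hmul]
  have hc := fun a b => (Conv.commute_const_scalar (k := k) (C := H) (A := H) a b).eq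
  -- The expression for l is nested inside that for g: the relation for l turns the inner sum
  -- around, constants pass scalars, and the relation for g then applies.
  calc _ = ∑ i ∈ G.index, Conv.const k H H (G.left i) *
        (∑ j ∈ L.index, Conv.const k H H (L.left j) * idConv k H *
          Conv.scalar H (evalRight f (L.right j))) * Conv.scalar H (evalRight f (G.right i)) := by
        simp only [Finset.mul_sum, Finset.sum_mul, mul_assoc]
    _ = ∑ j ∈ L.index, Conv.scalar H (evalRight f (L.left j)) *
        (∑ i ∈ G.index, Conv.const k H H (G.left i) * idConv k H *
          Conv.scalar H (evalRight f (G.right i))) * Conv.const k H H (L.right j) := by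
        rw [hl']
        simp only [Finset.mul_sum, Finset.sum_mul]
        rw [Finset.sum_comm]
        refine Finset.sum_congr rfl fun j _ => Finset.sum_congr rfl fun i _ => ?_
        simp only [mul_assoc]
        rw [hc, ← mul_assoc (Conv.const k H H (G.left i)), hc]
        simp only [mul_assoc]
    _ = _ := by
        rw [hg', Finset.sum_comm]
        simp only [Finset.mul_sum, Finset.sum_mul, mul_assoc]

end Bialg

/-! ### Forms on E(n) and their values on generators -/

namespace E

variable {k : Type*} [Field k] {n : ℕ}

open Bialg

/-- The elements `1`, `c`, `x_1, …, x_n`, which span a subcoalgebra. -/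
inductive IsGen : E k n → Prop
  | one : IsGen 1
  | c : IsGen (c k n)
  | x (i : Fin n) : IsGen (x k i)

variable (k n) in
def reprOne : Coalgebra.Repr k (1 : E k n) Unit :=
  ⟨{()}, fun _ => 1, fun _ => 1, by simp [Algebra.TensorProduct.one_def]⟩

variable (k n) in
def reprC : Coalgebra.Repr k (c k n) Unit :=
  ⟨{()}, fun _ => c k n, fun _ => c k n, by simp [comul_c]⟩

variable (k) in
def reprX (i : Fin n) : Coalgebra.Repr k (x k i) Bool :=
  ⟨Finset.univ, fun b => cond b 1 (x k i), fun b => cond b (x k i) (c k n), by simp [comul_x]⟩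

section eval

variable {A : Type*} [Ring A] [Algebra k A]

section
variable (f g : WithConv (E k n →ₗ[k] A))

theorem conv_one : (f * g) 1 = f 1 * g 1 := by
  rw [(reprOne k n).convMul_apply]
  simp [reprOne]

theorem conv_c : (f * g) (c k n) = f (c k n) * g (c k n) := by
  rw [(reprC k n).convMul_apply]
  simp [reprC]

theorem conv_x (i : Fin n) : (f * g) (x k i) = f 1 * g (x k i) + f (x k i) * g (c k n) := by
  rw [(reprX k i).convMul_apply]
  simp [reprX]

end

/-- Convolution on the right preserves agreement on generators. -/
theorem conv_congr {f f' g g' : WithConv (E k n →ₗ[k] A)} (hf : ∀ a, IsGen a → f a = f' a)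
    (hg : ∀ a, IsGen a → g a = g' a) (a : E k n) (ha : IsGen a) : (f * g) a = (f' * g') a := by
  cases ha with
  | one => simp only [conv_one, hf _ .one, hg _ .one]
  | c => simp only [conv_c, hf _ .c, hg _ .c]
  | x i => simp only [conv_x, hf _ .one, hg _ .c, hf _ (.x i), hg _ (.x i)]

variable (F G : WithConv (E k n ⊗[k] E k n →ₗ[k] A))

theorem conv_c_c :
    (F * G) (c k n ⊗ₜ c k n) = F (c k n ⊗ₜ c k n) * G (c k n ⊗ₜ c k n) := by
  rw [convMul_tmul_apply _ _ (reprC k n) (reprC k n)]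
  simp [reprC]

theorem conv_c_x (i : Fin n) :
    (F * G) (c k n ⊗ₜ x k i) = F (c k n ⊗ₜ 1) * G (c k n ⊗ₜ x k i) +
      F (c k n ⊗ₜ x k i) * G (c k n ⊗ₜ c k n) := by
  rw [convMul_tmul_apply _ _ (reprC k n) (reprX k i)]
  simp [reprC, reprX]

theorem conv_x_c (i : Fin n) :
    (F * G) (x k i ⊗ₜ c k n) = F (1 ⊗ₜ c k n) * G (x k i ⊗ₜ c k n) +
      F (x k i ⊗ₜ c k n) * G (c k n ⊗ₜ c k n) := by
  rw [convMul_tmul_apply _ _ (reprX k i) (reprC k n)]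
  simp [reprC, reprX]

theorem conv_x_x (i j : Fin n) :
    (F * G) (x k i ⊗ₜ x k j) = F (1 ⊗ₜ 1) * G (x k i ⊗ₜ x k j) +
      F (1 ⊗ₜ x k j) * G (x k i ⊗ₜ c k n) + (F (x k i ⊗ₜ 1) * G (c k n ⊗ₜ x k j) +
      F (x k i ⊗ₜ x k j) * G (c k n ⊗ₜ c k n)) := by
  rw [convMul_tmul_apply _ _ (reprX k i) (reprX k j)]
  simp [reprX]

end eval

/-- `f` has the counit as its restriction to `1 ⊗ -` and `- ⊗ 1`, vanishes at `c ⊗ x_i` and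
`x_i ⊗ c`, and takes the values `e` at `c ⊗ c` and `B i j` at `x_i ⊗ x_j`. -/
structure IsNormal (f : Form k (E k n)) (e : k) (B : Fin n → Fin n → k) : Prop where
  left_one : evalLeft f 1 = 1
  right_one : evalRight f 1 = 1
  c_c : f (c k n ⊗ₜ c k n) = e
  c_x (i) : f (c k n ⊗ₜ x k i) = 0
  x_c (i) : f (x k i ⊗ₜ c k n) = 0
  x_x (i j) : f (x k i ⊗ₜ x k j) = B i j

namespace IsNormal

variable {f g : Form k (E k n)} {e e' : k} {B B' : Fin n → Fin n → k}

theorem one_apply (hf : IsNormal f e B) (b : E k n) :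
    f (1 ⊗ₜ b) = Coalgebra.counit (R := k) b :=
  congrArg (fun u : WithConv (E k n →ₗ[k] k) => u b) hf.left_one

theorem apply_one (hf : IsNormal f e B) (a : E k n) :
    f (a ⊗ₜ 1) = Coalgebra.counit (R := k) a :=
  congrArg (fun u : WithConv (E k n →ₗ[k] k) => u a) hf.right_one

theorem flip (hf : IsNormal f e B) :
    IsNormal (Conv.pull (flipMap k (E k n)) f) e fun i j => B j i where
  left_one := hf.right_one
  right_one := hf.left_one
  c_c := hf.c_c
  c_x := hf.x_c
  x_c := hf.c_x
  x_x i j := hf.x_x j i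

/-- Of the four terms of Δ(x_i) and Δ(x_j) together, the two mixed ones vanish. The factor e' comes
from x_i ⊗ c in Δ(x_i). -/
theorem mul (hf : IsNormal f e B) (hg : IsNormal g e' B') :
    IsNormal (f * g) (e * e') fun i j => B' i j + B i j * e' where
  left_one := by rw [evalLeft_one_mul, hf.left_one, hg.left_one, one_mul]
  right_one := by rw [evalRight_one_mul, hf.right_one, hg.right_one, one_mul]
  c_c := by rw [conv_c_c, hf.c_c, hg.c_c]
  c_x i := by rw [conv_c_x, hf.c_x, hg.c_x, zero_mul, mul_zero, add_zero]
  x_c i := by rw [conv_x_c, hf.x_c, hg.x_c, zero_mul, mul_zero, add_zero]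
  x_x i j := by
    rw [conv_x_x, hf.x_x, hg.x_x, hg.c_c, hg.c_x, hg.x_c, hf.one_apply, Bialgebra.counit_one]
    ring

end IsNormal

theorem chi_c : chi k n (c k n) = -1 := lift_c _ _ _ _ _ _

theorem chi_x (i : Fin n) : chi k n (x k i) = 0 := lift_x _ _ _ _ _ _ i

theorem x_mul_c_ne_zero (i : Fin n) : x k i * c k n ≠ 0 := by
  -- A two-dimensional representation in which every x_i acts by the same square-zero matrix.
  let φ : E k n →ₐ[k] Matrix (Fin 2) (Fin 2) k :=
    lift !![-1, 0; 0, 1] (fun _ => !![0, 1; 0, 0])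
      (by ext a b; fin_cases a <;> fin_cases b <;> simp)
      (by intro i; ext a b; fin_cases a <;> fin_cases b <;> simp)
      (by intro i; ext a b; fin_cases a <;> fin_cases b <;> simp)
      (by intro i j; ext a b; fin_cases a <;> fin_cases b <;> simp)
  intro h
  have h' := congrFun (congrFun (congrArg φ h) 0) 1
  simp [φ] at h'

/-- The commutation axiom at c ⊗ x_i reads r(c ⊗ x_i) c + r(c ⊗ c) x_i c = c x_i + r(c ⊗ x_i).
Applying χ gives 2 r(c ⊗ x_i) = 0; what remains is r(c ⊗ c) x_i c = -x_i c. The pair x_i ⊗ c is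
treated with χ as well. -/
theorem isNormal_of_isCoquasitriangular (h2 : (2 : k) ≠ 0) (hn : 1 ≤ n) {r : Form k (E k n)}
    (hr : IsCoquasitriangular r) : IsNormal r (-1) fun i j => r (x k i ⊗ₜ x k j) := by
  have hl := evalLeft_one hr.isUnit ((mul_left_iff r).1 hr.mul_left)
  have hr1 := evalRight_one hr.isUnit ((mul_right_iff r).1 hr.mul_right)
  have one_apply : ∀ b, r (1 ⊗ₜ b) = Coalgebra.counit (R := k) b := fun b =>
    congrArg (fun u : WithConv (E k n →ₗ[k] k) => u b) hl
  have apply_one : ∀ b, r (b ⊗ₜ 1) = Coalgebra.counit (R := k) b := fun b =>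
    congrArg (fun u : WithConv (E k n →ₗ[k] k) => u b) hr1
  have hcomm : ∀ t, (muOp k (E k n) * Conv.scalar (E k n) r) t =
      (Conv.scalar (E k n) r * mu k (E k n)) t :=
    fun t => by rw [hr.comm]
  have hmu : ∀ a b : E k n, mu k (E k n) (a ⊗ₜ[k] b) = a * b := fun _ _ => rfl
  have hmuOp : ∀ a b : E k n, muOp k (E k n) (a ⊗ₜ[k] b) = b * a := fun _ _ => rfl
  have hcx : ∀ i, r (c k n ⊗ₜ x k i) = 0 ∧ r (c k n ⊗ₜ c k n) = -1 := by
    intro i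
    have h := hcomm (c k n ⊗ₜ x k i)
    simp only [conv_c_x, Conv.scalar_apply, hmu, hmuOp, apply_one, counit_c, c_mul_c, map_one,
      one_mul, mul_one] at h
    have h' := congrArg (chi k n) h
    simp only [map_add, map_mul, chi_c, chi_x, AlgHom.commutes, Algebra.algebraMap_self,
      RingHom.id_apply, mul_zero, zero_mul, add_zero, zero_add] at h'
    have h0 : r (c k n ⊗ₜ x k i) = 0 := by
      have : (2 : k) * r (c k n ⊗ₜ x k i) = 0 := by linear_combination -h'
      exact (mul_eq_zero.1 this).resolve_left h2
    refine ⟨h0, ?_⟩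
    rw [h0, map_zero, mul_zero, zero_add, add_zero, c_mul_x, ← Algebra.commutes,
      ← Algebra.smul_def, ← neg_one_smul k] at h
    exact smul_left_injective k (x_mul_c_ne_zero i) h
  -- Some x_i is needed here: on the group algebra E(0), ε ⊗ ε is also coquasi-triangular.
  have hcc := (hcx ⟨0, hn⟩).2
  refine ⟨hl, hr1, hcc, fun i => (hcx i).1, fun i => ?_, fun i j => rfl⟩
  have h := congrArg (chi k n) (hcomm (x k i ⊗ₜ c k n))
  simp only [conv_x_c, Conv.scalar_apply, hmu, hmuOp, one_apply, counit_c, c_mul_c, map_one,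
    one_mul, mul_one] at h
  simp only [map_add, map_mul, chi_c, chi_x, AlgHom.commutes, Algebra.algebraMap_self,
      RingHom.id_apply, mul_zero, zero_mul, add_zero, zero_add] at h
  have : (2 : k) * r (x k i ⊗ₜ c k n) = 0 := by linear_combination -h
  exact (mul_eq_zero.1 this).resolve_left h2

/-- The value -1 at c ⊗ c compensates the anticommutation of the generators. B contributes the same
scalar to both sides, so it is arbitrary. -/
theorem comm_of_isGen {f : Form k (E k n)} {B : Fin n → Fin n → k} (hf : IsNormal f (-1) B)
    (h g : E k n) (hh : IsGen h) (hg : IsGen g) :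
    (muOp k (E k n) * Conv.scalar (E k n) f) (h ⊗ₜ g) =
      (Conv.scalar (E k n) f * mu k (E k n)) (h ⊗ₜ g) := by
  have hmu : ∀ a b : E k n, mu k (E k n) (a ⊗ₜ[k] b) = a * b := fun _ _ => rfl
  have hmuOp : ∀ a b : E k n, muOp k (E k n) (a ⊗ₜ[k] b) = b * a := fun _ _ => rfl
  cases hh with
  | one =>
    rw [convMul_tmul_apply _ _ (reprOne k n) (Coalgebra.Repr.arbitrary k g),
      convMul_tmul_apply _ _ (reprOne k n) (Coalgebra.Repr.arbitrary k g)]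
    simp only [reprOne, Finset.sum_singleton, Conv.scalar_apply, hmu, hmuOp, hf.one_apply, one_mul,
      mul_one]
    simp only [← Algebra.commutes, ← Algebra.smul_def]
    rw [sum_counit_right_smul, Coalgebra.sum_counit_smul]
  | c =>
    cases hg with
    | one =>
      rw [convMul_tmul_apply _ _ (reprC k n) (reprOne k n),
        convMul_tmul_apply _ _ (reprC k n) (reprOne k n)]
      simp [reprC, reprOne, Conv.scalar_apply, hmu, hmuOp, hf.apply_one, counit_c]
    | c =>
      rw [conv_c_c, conv_c_c]
      simp [Conv.scalar_apply, hmu, hmuOp, hf.c_c]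
    | x i =>
      rw [conv_c_x, conv_c_x]
      simp [Conv.scalar_apply, hmu, hmuOp, hf.c_c, hf.c_x, hf.apply_one, counit_c,
        c_mul_x]
  | x i =>
    cases hg with
    | one =>
      rw [convMul_tmul_apply _ _ (reprX k i) (reprOne k n),
        convMul_tmul_apply _ _ (reprX k i) (reprOne k n)]
      simp [reprX, reprOne, Conv.scalar_apply, hmu, hmuOp, hf.apply_one, counit_x, counit_c]
    | c =>
      rw [conv_x_c, conv_x_c]
      simp [Conv.scalar_apply, hmu, hmuOp, hf.c_c, hf.x_c, hf.one_apply, counit_c,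
        c_mul_x]
    | x j =>
      rw [conv_x_x, conv_x_x]
      simp [Conv.scalar_apply, hmu, hmuOp, hf.c_c, hf.x_c, hf.c_x, hf.x_x, hf.one_apply,
        hf.apply_one, counit_x, c_mul_c, x_mul_x k i j, add_comm]

/-- The generators span a subcoalgebra, so for a generator g the axiom extends from generators h to
all h by the algebra maps `mulEval` and `evalMul`; `comm_mul_right` then extends it to all g. -/
theorem comm_of_isNormal {f : Form k (E k n)} {B : Fin n → Fin n → k} (hf : IsNormal f (-1) B)
    (hl : ∀ a b, evalLeft f (a * b) = evalLeft f a * evalLeft f b)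
    (hr : ∀ b l, evalRight f (b * l) = evalRight f l * evalRight f b) :
    muOp k (E k n) * Conv.scalar (E k n) f = Conv.scalar (E k n) f * mu k (E k n) := by
  have h1 : ∀ h g : E k n, IsGen g →
      (idConv k (E k n) * mulEval f hf.left_one hl h) g = (evalMul f hf.left_one hl h * idConv k (E k n)) g := by
    have base : ∀ h : E k n, IsGen h → ∀ g, IsGen g →
        (idConv k (E k n) * mulEval f hf.left_one hl h) g =
          (evalMul f hf.left_one hl h * idConv k (E k n)) g := fun h hh g hg => by
      rw [← muOp_mul_scalar_apply, ← scalar_mul_mu_apply, comm_of_isGen hf h g hh hg]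
    intro h
    induction h using E.induction with
    | hk t =>
      intro g _
      rw [AlgHom.commutes, AlgHom.commutes, Algebra.commutes]
    | hc => exact base _ .c
    | hx i => exact base _ (.x i)
    | hmul a b ha hb =>
      intro g hg
      -- id * P(a) * P(b) = Q(a) * id * P(b) = Q(a) * Q(b) * id, on generators.
      rw [map_mul, map_mul, ← mul_assoc, conv_congr ha (fun _ _ => rfl) g hg, mul_assoc,
        conv_congr (fun _ _ => rfl) hb g hg, mul_assoc]
    | hadd a b ha hb =>
      intro g hg
      rw [map_add, map_add, mul_add, add_mul]
      exact congrArg₂ (· + ·) (ha g hg) (hb g hg)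
  have h2 : ∀ g h : E k n,
      (muOp k (E k n) * Conv.scalar (E k n) f) (h ⊗ₜ g) =
      (Conv.scalar (E k n) f * mu k (E k n)) (h ⊗ₜ g) := by
    have base : ∀ g : E k n, IsGen g → ∀ h,
        (muOp k (E k n) * Conv.scalar (E k n) f) (h ⊗ₜ g) = (Conv.scalar (E k n) f * mu k (E k n)) (h ⊗ₜ g) :=
      fun g hg h => by
        rw [muOp_mul_scalar_apply f hf.left_one hl, scalar_mul_mu_apply f hf.left_one hl, h1 h g hg]
    intro g
    induction g using E.induction with
    | hk t =>
      intro h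
      rw [Algebra.algebraMap_eq_smul_one, TensorProduct.tmul_smul, map_smul, map_smul,
        base 1 .one]
    | hc => exact base _ .c
    | hx i => exact base _ (.x i)
    | hmul a b ha hb => exact comm_mul_right hr ha hb
    | hadd a b ha hb =>
      intro h
      rw [TensorProduct.tmul_add, map_add, map_add, ha, hb]
  exact WithConv.ext (TensorProduct.ext' fun h g => h2 g h)

/-- A form that is multiplicative in both arguments is determined by its values on generators. -/
theorem form_eq_of_isNormal {f g : Form k (E k n)} {e : k} {B : Fin n → Fin n → k}
    (hf : IsNormal f e B) (hg : IsNormal g e B)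
    (hfl : ∀ a b, evalLeft f (a * b) = evalLeft f a * evalLeft f b)
    (hfr : ∀ b l, evalRight f (b * l) = evalRight f l * evalRight f b)
    (hgl : ∀ a b, evalLeft g (a * b) = evalLeft g a * evalLeft g b)
    (hgr : ∀ b l, evalRight g (b * l) = evalRight g l * evalRight g b) : f = g := by
  have base : ∀ a b : E k n, IsGen a → IsGen b → f (a ⊗ₜ b) = g (a ⊗ₜ b) := by
    intro a b ha hb
    cases ha with
    | one => rw [hf.one_apply, hg.one_apply]
    | c =>
      cases hb with
      | one => rw [hf.apply_one, hg.apply_one]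
      | c => rw [hf.c_c, hg.c_c]
      | x i => rw [hf.c_x, hg.c_x]
    | x i =>
      cases hb with
      | one => rw [hf.apply_one, hg.apply_one]
      | c => rw [hf.x_c, hg.x_c]
      | x j => rw [hf.x_x, hg.x_x]
  have h1 : ∀ a b : E k n, IsGen b → evalLeft f a b = evalLeft g a b := by
    intro a
    induction a using E.induction with
    | hk t =>
      intro b hb
      rw [Algebra.algebraMap_eq_smul_one, map_smul, map_smul, hf.left_one, hg.left_one]
    | hc => exact fun b hb => base _ b .c hb
    | hx i => exact fun b hb => base _ b (.x i) hb
    | hmul a a' ha ha' =>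
      rw [hfl, hgl]
      exact conv_congr ha ha'
    | hadd a a' ha ha' =>
      intro b hb
      rw [map_add, map_add]
      exact congrArg₂ (· + ·) (ha b hb) (ha' b hb)
  have h2 : ∀ b, evalRight f b = evalRight g b := by
    have base' : ∀ b, IsGen b → evalRight f b = evalRight g b := fun b hb =>
      WithConv.ext (LinearMap.ext fun a => h1 a b hb)
    intro b
    induction b using E.induction with
    | hk t =>
      rw [Algebra.algebraMap_eq_smul_one, map_smul, map_smul, hf.right_one, hg.right_one]
    | hc => exact base' _ .c
    | hx i => exact base' _ (.x i)
    | hmul b b' hb hb' => rw [hfr, hgr, hb, hb']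
    | hadd b b' hb hb' => rw [map_add, map_add, hb, hb']
  exact form_ext fun a b => congrArg (fun u : WithConv (E k n →ₗ[k] k) => u a) (h2 b)

/-! ### Rescaling the matrix of a coquasi-triangular structure -/

/-- The bialgebra endomorphism `c ↦ c`, `x_i ↦ t x_i`. -/
def scale (t : k) : E k n →ₐc[k] E k n :=
  BialgHom.ofAlgHom
    (lift (c k n) (fun i => t • x k i) (c_mul_c k n) (by simp [x_mul_self]) (by simp [c_mul_x])
      (by
        intro i j
        rw [smul_mul_smul_comm, smul_mul_smul_comm, x_mul_x k i j, smul_neg]))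
    (by
      apply hom_ext
      · simp [counit_c]
      · intro i
        simp [counit_x])
    (by
      apply hom_ext
      · simp [comul_c]
      · intro i
        simp [comul_x, TensorProduct.tmul_smul, TensorProduct.smul_tmul'])

theorem scale_c (t : k) : scale t (c k n) = c k n := lift_c _ _ _ _ _ _

theorem scale_x (t : k) (i : Fin n) : scale t (x k i) = t • x k i := lift_x _ _ _ _ _ _ i

/-- `f(s ⊗ 1)`, where `s` is the rescaling of the `x_i` by `t`. -/
def scaleForm (t : k) (f : Form k (E k n)) : Form k (E k n) :=
  Conv.pull (Coalgebra.TensorProduct.map ((scale t : E k n →ₐc[k] E k n) : E k n →ₗc[k] E k n)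
    (.id k (E k n))) f

theorem scaleForm_apply (t : k) (f : Form k (E k n)) (a b : E k n) :
    scaleForm t f (a ⊗ₜ b) = f (scale t a ⊗ₜ b) := rfl

theorem evalRight_scaleForm (t : k) (f : Form k (E k n)) (b : E k n) :
    evalRight (scaleForm t f) b =
      Conv.pull ((scale t : E k n →ₐc[k] E k n) : E k n →ₗc[k] E k n) (evalRight f b) := rfl

theorem evalLeft_scaleForm (t : k) (f : Form k (E k n)) (a : E k n) :
    evalLeft (scaleForm t f) a = evalLeft f (scale t a) := rfl

theorem IsNormal.scaleForm {f : Form k (E k n)} {e : k} {B : Fin n → Fin n → k}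
    (hf : IsNormal f e B) (t : k) : IsNormal (scaleForm t f) e fun i j => t * B i j where
  left_one := by rw [evalLeft_scaleForm, map_one, hf.left_one]
  right_one := by rw [evalRight_scaleForm, hf.right_one, map_one]
  c_c := by rw [scaleForm_apply, scale_c, hf.c_c]
  c_x i := by rw [scaleForm_apply, scale_c, hf.c_x]
  x_c i := by
    rw [scaleForm_apply, scale_x, ← TensorProduct.smul_tmul', map_smul, hf.x_c, smul_zero]
  x_x i j := by
    rw [scaleForm_apply, scale_x, ← TensorProduct.smul_tmul', map_smul, hf.x_x, smul_eq_mul]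

theorem isCoquasitriangular_of_isNormal {f : Form k (E k n)} {B : Fin n → Fin n → k}
    (hu : IsUnit f) (hf : IsNormal f (-1) B)
    (hl : ∀ a b, evalLeft f (a * b) = evalLeft f a * evalLeft f b)
    (hr : ∀ b l, evalRight f (b * l) = evalRight f l * evalRight f b) : IsCoquasitriangular f :=
  ⟨hu, (mul_left_iff f).2 hl, (mul_right_iff f).2 hr, comm_of_isNormal hf hl hr⟩

/-- Pulling back one argument along a bialgebra map keeps both multiplicativity axioms, and the
commutation axiom holds for any matrix. -/
theorem isCoquasitriangular_scaleForm {f : Form k (E k n)} {B : Fin n → Fin n → k}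
    (hc : IsCoquasitriangular f) (hf : IsNormal f (-1) B) (t : k) :
    IsCoquasitriangular (scaleForm t f) := by
  refine isCoquasitriangular_of_isNormal (hc.isUnit.map _) (hf.scaleForm t) (fun a b => ?_)
    fun b l => ?_
  · simp only [evalLeft_scaleForm, map_mul, (mul_left_iff f).1 hc.mul_left]
  · simp only [evalRight_scaleForm, map_mul, (mul_right_iff f).1 hc.mul_right]

/-! ### The base point r_0 -/

section r0

variable (k n) in
/-- The character `χ`, as an element of the convolution algebra. -/
def chiConv : WithConv (E k n →ₗ[k] k) := toConv (chi k n).toLinearMap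

/-- χ * χ is again an algebra map, so comparison with ε on generators suffices. -/
theorem chiConv_mul_self : chiConv k n * chiConv k n = 1 := by
  let φ : E k n →ₐ[k] k :=
    (Algebra.TensorProduct.lmul' k).comp
      ((Algebra.TensorProduct.map (chi k n) (chi k n)).comp (Bialgebra.comulAlgHom k (E k n)))
  have h : φ = Bialgebra.counitAlgHom k (E k n) := by
    apply hom_ext
    · simp [φ, comul_c, counit_c, chi_c]
    · intro i
      simp [φ, comul_x, counit_x, chi_x]
  exact WithConv.ext (congrArg AlgHom.toLinearMap h)

theorem r0_apply (h2 : (2 : k) ≠ 0) (a b : E k n) :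
    r0 k n (a ⊗ₜ b) = 2⁻¹ * ((Coalgebra.counit (R := k) a + chi k n a) *
        Coalgebra.counit (R := k) b +
      (Coalgebra.counit (R := k) a - chi k n a) * chi k n b) := by
  have e : ∀ a : E k n, counitHom k n a = Coalgebra.counit (R := k) a := fun _ => rfl
  have h : ∀ f g : E k n →ₗ[k] k, tensorForm k n f g (a ⊗ₜ b) = f a * g b := fun _ _ => rfl
  change tensorForm k n _ _ (a ⊗ₜ b) + tensorForm k n _ _ (a ⊗ₜ b) + tensorForm k n _ _ (a ⊗ₜ b) -
    tensorForm k n _ _ (a ⊗ₜ b) = _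
  simp only [h, oneDual, cDual, LinearMap.smul_apply, LinearMap.add_apply, LinearMap.sub_apply,
    AlgHom.toLinearMap_apply, smul_eq_mul, e]
  field_simp
  ring

theorem r0_apply_comm (h2 : (2 : k) ≠ 0) (a b : E k n) : r0 k n (a ⊗ₜ b) = r0 k n (b ⊗ₜ a) := by
  rw [r0_apply h2, r0_apply h2]
  ring

/-- All functions r_0(a ⊗ -) lie in the commutative span of 1 and the involution χ, so both
multiplicativity axioms reduce to arithmetic of coefficients. -/
theorem evalLeft_r0 (h2 : (2 : k) ≠ 0) (a : E k n) :
    evalLeft (r0 k n) a =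
      (2⁻¹ * (Coalgebra.counit (R := k) a + chi k n a)) • (1 : WithConv (E k n →ₗ[k] k)) +
        (2⁻¹ * (Coalgebra.counit (R := k) a - chi k n a)) • chiConv k n := by
  apply WithConv.ext
  apply LinearMap.ext
  intro b
  refine (r0_apply h2 a b).trans ?_
  change _ = (2⁻¹ * (Coalgebra.counit (R := k) a + chi k n a)) * Coalgebra.counit (R := k) b +
    (2⁻¹ * (Coalgebra.counit (R := k) a - chi k n a)) * chi k n b
  ring

theorem evalRight_r0 (h2 : (2 : k) ≠ 0) (a : E k n) :
    evalRight (r0 k n) a = evalLeft (r0 k n) a :=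
  WithConv.ext (LinearMap.ext fun b => r0_apply_comm h2 b a)

theorem mul_of_mul_self_eq_one {A : Type*} [Ring A] [Algebra k A] {u : A} (hu : u * u = 1)
    (p q p' q' : k) : (p • (1 : A) + q • u) * (p' • (1 : A) + q' • u) =
      (p * p' + q * q') • (1 : A) + (p * q' + q * p') • u := by
  simp only [add_mul, mul_add, smul_mul_smul_comm, one_mul, mul_one, hu, add_smul]
  abel

theorem evalLeft_r0_mul (h2 : (2 : k) ≠ 0) (a b : E k n) :
    evalLeft (r0 k n) (a * b) = evalLeft (r0 k n) a * evalLeft (r0 k n) b := by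
  rw [evalLeft_r0 h2, evalLeft_r0 h2, evalLeft_r0 h2, mul_of_mul_self_eq_one chiConv_mul_self,
    Bialgebra.counit_mul, map_mul]
  congr 2 <;> (field_simp; ring)

theorem evalLeft_r0_mul_comm (h2 : (2 : k) ≠ 0) (a b : E k n) :
    evalLeft (r0 k n) a * evalLeft (r0 k n) b = evalLeft (r0 k n) b * evalLeft (r0 k n) a := by
  rw [evalLeft_r0 h2, evalLeft_r0 h2, mul_of_mul_self_eq_one chiConv_mul_self,
    mul_of_mul_self_eq_one chiConv_mul_self]
  congr 2 <;> ring

theorem tensorForm_mul (f g f' g' : WithConv (E k n →ₗ[k] k)) :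
    tensorForm k n f.ofConv g.ofConv * tensorForm k n f'.ofConv g'.ofConv =
      tensorForm k n (f * f').ofConv (g * g').ofConv := by
  refine form_ext fun a b => ?_
  set A := Coalgebra.Repr.arbitrary k a
  set B := Coalgebra.Repr.arbitrary k b
  refine (convMul_tmul_apply _ _ A B).trans ?_
  change _ = (f * f') a * (g * g') b
  rw [A.convMul_apply, B.convMul_apply, Finset.sum_mul_sum]
  refine Finset.sum_congr rfl fun i _ => Finset.sum_congr rfl fun j _ => ?_
  exact mul_mul_mul_comm _ _ _ _

theorem tensorForm_one : tensorForm k n (ofConv 1) (ofConv 1) = 1 := by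
  refine form_ext fun a b => ?_
  simp [tensorForm, mul_comm]

theorem r0_eq (h2 : (2 : k) ≠ 0) :
    r0 k n = (2⁻¹ : k) • (1 + tensorForm k n (chiConv k n).ofConv (ofConv 1) +
      (tensorForm k n (ofConv 1) (chiConv k n).ofConv -
        tensorForm k n (chiConv k n).ofConv (chiConv k n).ofConv)) := by
  refine form_ext fun a b => (r0_apply h2 a b).trans ?_
  rw [← tensorForm_one]
  change _ = 2⁻¹ * (Coalgebra.counit (R := k) a * Coalgebra.counit (R := k) b +
    chi k n a * Coalgebra.counit (R := k) b + (Coalgebra.counit (R := k) a * chi k n b -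
      chi k n a * chi k n b))
  ring

/-- r_0 = (1 + a + b - ab)/2 with the commuting involutions a = χ ⊗ ε and b = ε ⊗ χ, and (1 + a + b
- ab)² = 4. -/
theorem r0_mul_self (h2 : (2 : k) ≠ 0) : r0 k n * r0 k n = 1 := by
  have hab : tensorForm k n (chiConv k n).ofConv (chiConv k n).ofConv =
      tensorForm k n (chiConv k n).ofConv (ofConv 1) *
        tensorForm k n (ofConv 1) (chiConv k n).ofConv := by
    rw [tensorForm_mul, mul_one, one_mul]
  have hba : tensorForm k n (ofConv 1) (chiConv k n).ofConv *
      tensorForm k n (chiConv k n).ofConv (ofConv 1) =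
        tensorForm k n (chiConv k n).ofConv (ofConv 1) *
        tensorForm k n (ofConv 1) (chiConv k n).ofConv := by
    rw [tensorForm_mul, tensorForm_mul, mul_one, one_mul]
  have haa : tensorForm k n (chiConv k n).ofConv (ofConv 1) *
      tensorForm k n (chiConv k n).ofConv (ofConv 1) = 1 := by
    rw [tensorForm_mul, mul_one, chiConv_mul_self, tensorForm_one]
  have hbb : tensorForm k n (ofConv 1) (chiConv k n).ofConv *
      tensorForm k n (ofConv 1) (chiConv k n).ofConv = 1 := by
    rw [tensorForm_mul, mul_one, chiConv_mul_self, tensorForm_one]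
  rw [r0_eq h2, hab]
  generalize tensorForm k n (chiConv k n).ofConv (ofConv 1) = a at *
  generalize tensorForm k n (ofConv 1) (chiConv k n).ofConv = b at *
  have h4 : (1 + a + (b - a * b)) * (1 + a + (b - a * b)) = (4 : k) • (1 : Form k (E k n)) := by
    have e1 : a * (a * b) = b := by rw [← mul_assoc, haa, one_mul]
    have e2 : b * (a * b) = a := by rw [← mul_assoc, hba, mul_assoc, hbb, mul_one]
    have e3 : a * b * a = b := by rw [mul_assoc, hba, e1]
    have e4 : a * b * b = a := by rw [mul_assoc, hbb, mul_one]
    have e5 : a * b * (a * b) = 1 := by rw [← mul_assoc, e3, hbb]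
    simp only [add_mul, mul_add, sub_mul, mul_sub, one_mul, mul_one, haa, hbb, hba, e1, e2, e3, e4,
      e5]
    rw [show (4 : k) = 1 + 1 + 1 + 1 by norm_num]
    simp only [add_smul, one_smul]
    abel
  rw [smul_mul_smul_comm, h4, smul_smul]
  rw [show (2⁻¹ : k) * 2⁻¹ * 4 = 1 by field_simp; norm_num, one_smul]

theorem isNormal_r0 (h2 : (2 : k) ≠ 0) : IsNormal (r0 k n) (-1) fun _ _ => 0 where
  left_one := by
    rw [evalLeft_r0 h2, Bialgebra.counit_one, map_one, sub_self, mul_zero, zero_smul, add_zero,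
      one_add_one_eq_two, inv_mul_cancel₀ h2, one_smul]
  right_one := by
    rw [evalRight_r0 h2, evalLeft_r0 h2, Bialgebra.counit_one, map_one, sub_self, mul_zero,
      zero_smul, add_zero, one_add_one_eq_two, inv_mul_cancel₀ h2, one_smul]
  c_c := by
    rw [r0_apply h2, counit_c, chi_c]
    field_simp
    ring
  c_x i := by rw [r0_apply h2, counit_x, chi_x]; ring
  x_c i := by rw [r0_apply h2, counit_x, chi_x]; ring
  x_x i j := by rw [r0_apply h2, counit_x, chi_x]; ring

theorem isCotriangular_r0 (h2 : (2 : k) ≠ 0) : IsCotriangular (r0 k n) where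
  toIsCoquasitriangular := by
    refine isCoquasitriangular_of_isNormal ?_ (isNormal_r0 h2) (evalLeft_r0_mul h2) fun b l => ?_
    · exact (⟨r0 k n, r0 k n, r0_mul_self h2, r0_mul_self h2⟩ : (Form k (E k n))ˣ).isUnit
    · rw [evalRight_r0 h2, evalRight_r0 h2, evalRight_r0 h2, evalLeft_r0_mul h2,
        evalLeft_r0_mul_comm h2]
  flip_mul := by
    have h : Conv.pull (flipMap k (E k n)) (r0 k n) = r0 k n :=
      form_ext fun a b => r0_apply_comm h2 b a
    rw [h, r0_mul_self h2]

end r0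

end E

end

/-! ### The orbit of r_0 -/

theorem mainTheorem9 (k : Type*) [Field k] (h2 : (2 : k) ≠ 0) (n : ℕ) (hn : 1 ≤ n) :
    {r : Bialg.Form k (E k n) | Bialg.IsCotriangular r} =
      MulAction.orbit (Bialg.ZL k (E k n)) (E.r0 k n) := by

  have smul_mul : ∀ σ : Bialg.ZL k (E k n),
      (σ • E.r0 k n : Bialg.Form k (E k n)) * (σ.toUnits : Bialg.Form k (E k n)) =
        Conv.pull (Bialg.flipMap k (E k n)) (σ.toUnits : Bialg.Form k (E k n)) * E.r0 k n :=
    fun σ => Units.inv_mul_cancel_right _ _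
  have twist : ∀ σ : Bialg.ZL k (E k n),
      Bialg.IsCotriangular (σ • E.r0 k n : Bialg.Form k (E k n)) :=
    fun σ => (E.isCotriangular_r0 h2).twist σ.2.1 σ.2.2 (smul_mul σ)
  apply Set.Subset.antisymm
  · intro r hr
    have hr : Bialg.IsCotriangular r := hr
    have hrn := E.isNormal_of_isCoquasitriangular h2 hn hr.toIsCoquasitriangular
    -- The value of (rτ) * r = ε ⊗ ε at x_i ⊗ x_j is B i j - B j i = 0.
    have hsymm : ∀ i j, r (E.x k j ⊗ₜ E.x k i) = r (E.x k i ⊗ₜ E.x k j) := fun i j => by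
      have h := (hrn.flip.mul hrn).x_x i j
      rw [hr.flip_mul] at h
      have h' : (1 : Bialg.Form k (E k n)) (E.x k i ⊗ₜ E.x k j) = 0 := by
        simp [E.counit_x]
      rw [h'] at h
      linear_combination h
    have h0 := E.isCotriangular_r0 (n := n) h2
    have h0n := E.isNormal_r0 (n := n) h2
    -- Scaling by t gives -t(B + Bᵀ) = -2tB as the matrix of σ · r_0, whence t = -1/2.
    have hs := E.isCoquasitriangular_scaleForm hr.toIsCoquasitriangular hrn (-2⁻¹)
    have hsn := hrn.scaleForm (-2⁻¹)
    have hσ : E.r0 k n * (E.r0 k n * E.scaleForm (-2⁻¹) r) = E.scaleForm (-2⁻¹) r := by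
      rw [← mul_assoc, E.r0_mul_self h2, one_mul]
    have hσc := hs.isLeftCocycle_of_mul_eq h0.toIsCoquasitriangular hσ
    obtain ⟨u, hu⟩ := hσc.isUnit
    let σ : Bialg.ZL k (E k n) :=
      ⟨u, hu ▸ hσc, hu ▸ hs.isLazy_of_mul_eq h0.toIsCoquasitriangular hσ⟩
    refine ⟨σ, ?_⟩
    have hR := twist σ
    have hRn := E.isNormal_of_isCoquasitriangular h2 hn hR.toIsCoquasitriangular
    have hσn := h0n.mul hsn
    rw [← hu] at hσn
    have hval : ∀ i j, (σ • E.r0 k n : Bialg.Form k (E k n)) (E.x k i ⊗ₜ E.x k j) =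
        r (E.x k i ⊗ₜ E.x k j) := fun i j => by
      have h := (hRn.mul hσn).x_x i j
      have h' := (hσn.flip.mul h0n).x_x i j
      have h'' := h.symm.trans ((congrArg (fun F : Bialg.Form k (E k n) =>
        F (E.x k i ⊗ₜ E.x k j)) (smul_mul σ)).trans h')
      simp only [hsymm] at h''
      have h3 : (2⁻¹ : k) * 2 = 1 := inv_mul_cancel₀ h2
      linear_combination h'' + r (E.x k i ⊗ₜ E.x k j) * h3
    simp only [hval] at hRn
    exact E.form_eq_of_isNormal hRn hrn
      ((Bialg.mul_left_iff _).1 hR.mul_left) ((Bialg.mul_right_iff _).1 hR.mul_right)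
      ((Bialg.mul_left_iff _).1 hr.mul_left) ((Bialg.mul_right_iff _).1 hr.mul_right)
  · rintro _ ⟨σ, rfl⟩
    exact twist σ
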